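/- A matchstick graph is a finite simple graph drawn in the Euclidean plane so that its vertices are distinct points, every edge is a straight-line segment of length $1$ joining its two endpoints, and edges intersect only at common endpoints (so no vertex lies in the relative interior of an edge, and the relative interiors of distinct edges are disjoint); it need not be connected. Let $G$ be a matchstick graph with $n \ge 1$ vertices and no isolated vertices (that is, no vertices of degree $0$), and for each $i$ let $n_i$ be the number of vertices of $G$ of degree $i$. Then $$4n_1 + 3n_2 + 2n_3 + n_4 > \sqrt{\pi\sqrt{3}\cdot n}.$$ -/

import Mathlib

/-- A matchstick graph with vertex set `V`: a simple graph drawn in the Euclidean plane, with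
distinct vertices at distinct points and each edge `uv` drawn as the straight segment from
`pos u` to `pos v` of length one, such that edges meet only at common endpoints.  The relative
interior of an edge is the open segment between its ends; it contains no vertex and no
interior point of another edge.  Connectedness is not required. -/
structure MatchstickGraph (V : Type*) where
  /-- The underlying abstract graph. -/
  graph : SimpleGraph V
  /-- The points at which the vertices are drawn. -/
  pos : V → EuclideanSpace ℝ (Fin 2)
  /-- Vertices are distinct points. -/
  pos_injective : Function.Injective pos
  /-- Edges have unit length. -/
  unit_length : ∀ u v, graph.Adj u v → dist (pos u) (pos v) = 1
  /-- No vertex lies in the relative interior of an edge. -/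
  vertex_not_mem_edge : ∀ u v w, graph.Adj u v → pos w ∉ openSegment ℝ (pos u) (pos v)
  /-- The relative interiors of two different edges are disjoint. -/
  edges_disjoint : ∀ u v x y, graph.Adj u v → graph.Adj x y → s(u, v) ≠ s(x, y) →
    Disjoint (openSegment ℝ (pos u) (pos v)) (openSegment ℝ (pos x) (pos y))

/-- The number `n_i` of vertices of degree `i`. -/
def MatchstickGraph.numDegree {V : Type*} [Fintype V] (G : MatchstickGraph V)
    [DecidableRel G.graph.Adj] (i : ℕ) : ℕ :=
  (Finset.univ.filter fun v : V => G.graph.degree v = i).card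

/-
Label every directed edge by the region to its left. The regions are found by first adding
straight edges while the drawing stays plane, until every corner smaller than `π` belongs to an
empty triangle, and then deleting the added edges one by one and merging the regions on their two
sides. An inner region then has positive area and turning at most `2π`, the outer one has turning
at most zero; nothing topological is needed.

Give a corner of angle `θ` the charge `3θ/π - 1`. The charges at a vertex of degree `d` sum to
`6 - d`; an inner region with `k` sides which turns once has charge `2k - 6`, and the outer region
with `b` sides has charge at least `2b`. Summing the charges of the regions gives
`n + b ≤ t + W`, where `t` is the number of triangles and `W = 4n₁ + 3n₂ + 2n₃ + n₄`.
Letting each inner region give part of its charge back to the vertices of its large angles, which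
costs nothing at a triangle and at most `2` at a rhombus, also gives `b ≤ W`.

The triangles have total area `t√3/4`, so the isoperimetric inequality for equilateral closed
polygons, proved by the discrete Fourier transform, yields `π√3 t < b²`. As `π√3 < 6`, it follows
that `π√3 n ≤ π√3 t + π√3 (W - b) < b² + (W + b)(W - b) = W²` unless `b < W` and `W + b < 6`;
then `b ≤ 2`, so there are no triangles, and `n ≤ 3`, which forces `W ≥ 6`.
-/

section Star

open Real

/-- The angle by which direction `x` must be turned counterclockwise to reach direction `y`. It
takes values in `(0, 2π]`: a full turn, not the zero angle, leads from `x` to `x` itself. -/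
noncomputable def ccwGap (x y : Real.Angle) : ℝ :=
  haveI : Fact (0 < 2 * π) := ⟨two_pi_pos⟩
  (AddCircle.equivIoc (2 * π) 0 (y - x) : ℝ)

theorem ccwGap_mem_Ioc (x y : Real.Angle) : ccwGap x y ∈ Set.Ioc 0 (2 * π) := by
  have : Fact (0 < 2 * π) := ⟨two_pi_pos⟩
  simpa only [ccwGap, zero_add] using (AddCircle.equivIoc (2 * π) 0 (y - x)).2

theorem ccwGap_pos (x y : Real.Angle) : 0 < ccwGap x y := (ccwGap_mem_Ioc x y).1

theorem ccwGap_le_two_pi (x y : Real.Angle) : ccwGap x y ≤ 2 * π := (ccwGap_mem_Ioc x y).2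

theorem coe_ccwGap (x y : Real.Angle) : (ccwGap x y : Real.Angle) = y - x :=
  haveI : Fact (0 < 2 * π) := ⟨two_pi_pos⟩
  AddCircle.coe_equivIoc (p := 2 * π) (a := 0) (y := y - x)

theorem ccwGap_eq_of_coe_eq {x y : Real.Angle} {t : ℝ} (ht : t ∈ Set.Ioc 0 (2 * π))
    (h : (t : Real.Angle) = y - x) : ccwGap x y = t := by
  have : Fact (0 < 2 * π) := ⟨two_pi_pos⟩
  refine (AddCircle.coe_eq_coe_iff_of_mem_Ioc (p := 2 * π) (a := 0) ?_ ?_).1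
    ((coe_ccwGap x y).trans h.symm) <;> rw [zero_add]
  exacts [ccwGap_mem_Ioc x y, ht]

theorem ccwGap_self (x : Real.Angle) : ccwGap x x = 2 * π :=
  ccwGap_eq_of_coe_eq ⟨two_pi_pos, le_rfl⟩ (by simp)

theorem ccwGap_right_injective (x : Real.Angle) : Function.Injective (ccwGap x) := fun y w h =>
  sub_left_injective <| show y - x = w - x by rw [← coe_ccwGap, h, coe_ccwGap]

theorem ccwGap_add_of_lt {x y w : Real.Angle} (h : ccwGap x y < ccwGap x w) :
    ccwGap x w = ccwGap x y + ccwGap y w := by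
  have hyw : ccwGap y w = ccwGap x w - ccwGap x y :=
    ccwGap_eq_of_coe_eq ⟨sub_pos.2 h, by linarith [ccwGap_pos x y, ccwGap_le_two_pi x w]⟩ (by
      rw [Angle.coe_sub, coe_ccwGap, coe_ccwGap, sub_sub_sub_cancel_right])
  rw [hyw, add_sub_cancel]

theorem ccwGap_sub_of_le {x x' y : Real.Angle} (hne : x ≠ x') (h : ccwGap x' y ≤ ccwGap x y) :
    ccwGap x x' = ccwGap x y - ccwGap x' y := by
  have hcoe : ((ccwGap x y - ccwGap x' y : ℝ) : Real.Angle) = x' - x := by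
    rw [Angle.coe_sub, coe_ccwGap, coe_ccwGap, sub_sub_sub_cancel_left]
  refine ccwGap_eq_of_coe_eq ⟨(sub_nonneg.2 h).lt_of_ne fun h0 => hne ?_, ?_⟩ hcoe
  · rw [← h0, Angle.coe_zero, eq_comm, sub_eq_zero] at hcoe
    exact hcoe.symm
  · linarith [ccwGap_pos x' y, ccwGap_le_two_pi x y]

variable {V : Type*}

/-- The member of the star `S` that follows `a` counterclockwise, for a family of directions `α`
(`a` itself when it is alone in `S`). -/
noncomputable def nextDir (α : V → Real.Angle) (S : Finset V) (a : V) : V :=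
  if h : S.Nonempty then (S.exists_min_image (fun b => ccwGap (α a) (α b)) h).choose else a

/-- The angle of the corner of the star `S` that starts at `a`. -/
noncomputable def cornerAngle (α : V → Real.Angle) (S : Finset V) (a : V) : ℝ :=
  ccwGap (α a) (α (nextDir α S a))

variable {α : V → Real.Angle} {S : Finset V}

theorem nextDir_mem (hS : S.Nonempty) (a : V) : nextDir α S a ∈ S := by
  rw [nextDir, dif_pos hS]
  exact (S.exists_min_image (fun b => ccwGap (α a) (α b)) hS).choose_spec.1

theorem cornerAngle_le (a : V) {b : V} (hb : b ∈ S) :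
    cornerAngle α S a ≤ ccwGap (α a) (α b) := by
  rw [cornerAngle, nextDir, dif_pos ⟨b, hb⟩]
  exact (S.exists_min_image (fun b => ccwGap (α a) (α b)) ⟨b, hb⟩).choose_spec.2 b hb

theorem nextDir_eq_of_forall_le (hinj : Set.InjOn α S) {a b : V} (hb : b ∈ S)
    (h : ∀ d ∈ S, ccwGap (α a) (α b) ≤ ccwGap (α a) (α d)) : nextDir α S a = b :=
  hinj (nextDir_mem ⟨b, hb⟩ a) hb <| ccwGap_right_injective _ <|
    (cornerAngle_le a hb).antisymm (h _ (nextDir_mem ⟨b, hb⟩ a))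

theorem nextDir_injOn (hinj : Set.InjOn α S) : Set.InjOn (nextDir α S) S := by
  intro a ha a' ha' h
  by_contra hne
  wlog hle : ccwGap (α a') (α (nextDir α S a)) ≤ ccwGap (α a) (α (nextDir α S a))
    generalizing a a'
  · exact this ha' ha h.symm (Ne.symm hne) (h ▸ le_of_not_ge hle)
  have hgap := ccwGap_sub_of_le (fun hα => hne (hinj ha ha' hα)) hle
  have hmin : ccwGap (α a) (α (nextDir α S a)) ≤ ccwGap (α a) (α a') := cornerAngle_le a ha'
  linarith [ccwGap_pos (α a') (α (nextDir α S a))]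

theorem exists_nextDir_eq (hinj : Set.InjOn α S) {w : V} (hw : w ∈ S) :
    ∃ p ∈ S, nextDir α S p = w :=
  Finset.surjOn_of_injOn_of_card_le (nextDir α S) (fun a ha => nextDir_mem ⟨a, ha⟩ a)
    (nextDir_injOn hinj) le_rfl hw

theorem nextDir_eq_self_iff (hinj : Set.InjOn α S) {a : V} (ha : a ∈ S) :
    nextDir α S a = a ↔ S = {a} := by
  constructor
  · intro h
    refine Finset.eq_singleton_iff_unique_mem.2 ⟨ha, fun b hb => ?_⟩
    have hle := cornerAngle_le (α := α) a hb
    rw [cornerAngle, h, ccwGap_self] at hle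
    exact hinj hb ha <| ccwGap_right_injective (α a) <|
      (ccwGap_self (α a)).symm ▸ (ccwGap_le_two_pi _ _).antisymm hle
  · rintro rfl
    exact Finset.mem_singleton.1 (nextDir_mem (Finset.singleton_nonempty a) a)

section Erase

variable [DecidableEq V]

theorem nextDir_erase_of_ne (hinj : Set.InjOn α S) {w a : V} (ha : a ∈ S)
    (h : nextDir α S a ≠ w) : nextDir α (S.erase w) a = nextDir α S a :=
  nextDir_eq_of_forall_le (hinj.mono (S.erase_subset w))
    (Finset.mem_erase.2 ⟨h, nextDir_mem ⟨a, ha⟩ a⟩)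
    fun _ hd => cornerAngle_le a (Finset.mem_of_mem_erase hd)

theorem nextDir_mem_erase (hinj : Set.InjOn α S) {w a : V} (hw : w ∈ S) (ha : a ∈ S)
    (haw : a ≠ w) : nextDir α S w ∈ S.erase w := by
  refine Finset.mem_erase.2 ⟨fun hself => haw ?_, nextDir_mem ⟨w, hw⟩ w⟩
  rw [(nextDir_eq_self_iff hinj hw).1 hself] at ha
  exact Finset.mem_singleton.1 ha

section EraseNext

variable {w a : V} (hinj : Set.InjOn α S) (hw : w ∈ S) (ha : a ∈ S) (haw : a ≠ w)
  (h : nextDir α S a = w)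
include hinj hw h

theorem ccwGap_eq_add_of_mem_erase {d : V} (hd : d ∈ S.erase w) :
    ccwGap (α a) (α d) = ccwGap (α a) (α w) + ccwGap (α w) (α d) := by
  have hle := cornerAngle_le (α := α) a (Finset.mem_of_mem_erase hd)
  rw [cornerAngle, h] at hle
  refine ccwGap_add_of_lt (hle.lt_of_ne fun heq => Finset.ne_of_mem_erase hd ?_)
  exact hinj (Finset.mem_of_mem_erase hd) hw (ccwGap_right_injective _ heq.symm)

include ha haw

theorem nextDir_erase_of_eq : nextDir α (S.erase w) a = nextDir α S w := by
  have hmem := nextDir_mem_erase hinj hw ha haw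
  refine nextDir_eq_of_forall_le (hinj.mono (S.erase_subset w)) hmem fun d hd => ?_
  rw [ccwGap_eq_add_of_mem_erase hinj hw h hd, ccwGap_eq_add_of_mem_erase hinj hw h hmem]
  exact add_le_add_right (cornerAngle_le w (Finset.mem_of_mem_erase hd)) _

theorem cornerAngle_erase_of_eq :
    cornerAngle α (S.erase w) a = cornerAngle α S a + cornerAngle α S w := by
  rw [cornerAngle, nextDir_erase_of_eq hinj hw ha haw h, cornerAngle, cornerAngle, h]
  exact ccwGap_eq_add_of_mem_erase hinj hw h (nextDir_mem_erase hinj hw ha haw)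

end EraseNext

theorem sum_cornerAngle_erase (hinj : Set.InjOn α S) {w a : V} (hw : w ∈ S) (ha : a ∈ S)
    (haw : a ≠ w) (h : nextDir α S a = w) (P : V → Prop) [DecidablePred P] (hP : P a ↔ P w) :
    ∑ b ∈ S.erase w with P b, cornerAngle α (S.erase w) b =
      ∑ b ∈ S with P b, cornerAngle α S b := by
  have hrest : ∀ b ∈ (S.erase w).erase a, cornerAngle α (S.erase w) b = cornerAngle α S b := by
    intro b hb
    obtain ⟨hba, hbS⟩ := Finset.mem_erase.1 hb
    rw [cornerAngle, nextDir_erase_of_ne hinj (Finset.mem_of_mem_erase hbS), cornerAngle]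
    exact fun hbw => hba (nextDir_injOn hinj (Finset.mem_of_mem_erase hbS) ha (hbw.trans h.symm))
  have haw' : a ∈ S.erase w := Finset.mem_erase.2 ⟨haw, ha⟩
  rw [Finset.sum_filter, Finset.sum_filter, ← Finset.add_sum_erase S _ hw,
    ← Finset.add_sum_erase _ _ haw', ← Finset.add_sum_erase _ _ haw',
    cornerAngle_erase_of_eq hinj hw ha haw h,
    Finset.sum_congr rfl fun b hb => by rw [hrest b hb]]
  simp only [hP]
  split_ifs <;> ring

end Erase

theorem sum_cornerAngle (hinj : Set.InjOn α S) (hS : S.Nonempty) :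
    ∑ a ∈ S, cornerAngle α S a = 2 * π := by
  classical
  induction hS using Finset.Nonempty.cons_induction with
  | singleton a =>
    rw [Finset.sum_singleton, cornerAngle,
      (nextDir_eq_self_iff hinj (Finset.mem_singleton_self a)).2 rfl, ccwGap_self]
  | cons w s hws hs ih =>
    have hw : w ∈ Finset.cons w s hws := Finset.mem_cons_self w s
    have herase : (Finset.cons w s hws).erase w = s := by
      rw [Finset.cons_eq_insert, Finset.erase_insert hws]
    obtain ⟨p, hp, hnext⟩ := exists_nextDir_eq hinj hw
    have hpw : p ≠ w := by
      rintro rfl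
      have hsingle := (nextDir_eq_self_iff hinj hw).1 hnext
      rw [hsingle, Finset.erase_singleton] at herase
      exact hs.ne_empty herase.symm
    have hsum := sum_cornerAngle_erase hinj hw hp hpw hnext (fun _ => True) Iff.rfl
    simp only [Finset.filter_true, herase] at hsum
    rw [← hsum]
    exact ih (hinj.mono (Finset.subset_cons hws))

end Star

section Area

open Real AffineMap

/-- The cross product of two plane vectors: the signed area of the parallelogram they span. -/
def crossProd (u w : ℂ) : ℝ := u.re * w.im - u.im * w.re

theorem neg_crossProd (u w : ℂ) : -crossProd u w = crossProd w u := by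
  simp only [crossProd]; ring

theorem crossProd_eq_norm_mul_sin (u w : ℂ) :
    crossProd u w = ‖u‖ * ‖w‖ * sin (ccwGap u.arg w.arg) := by
  rw [← Angle.sin_coe, coe_ccwGap, ← Angle.coe_sub, Angle.sin_coe, sin_sub, crossProd,
    ← Complex.norm_mul_cos_arg u, ← Complex.norm_mul_sin_arg u, ← Complex.norm_mul_cos_arg w,
    ← Complex.norm_mul_sin_arg w]
  ring

theorem inner_eq_norm_mul_cos (u w : ℂ) :
    inner ℝ u w = ‖u‖ * ‖w‖ * cos (ccwGap u.arg w.arg) := by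
  rw [← Angle.cos_coe, coe_ccwGap, ← Angle.coe_sub, Angle.cos_coe, cos_sub, Complex.inner,
    Complex.mul_re, Complex.conj_re, Complex.conj_im, ← Complex.norm_mul_cos_arg u,
    ← Complex.norm_mul_sin_arg u, ← Complex.norm_mul_cos_arg w, ← Complex.norm_mul_sin_arg w]
  ring

theorem ccwGap_arg_lt_pi_iff {u w : ℂ} (hu : u ≠ 0) (hw : w ≠ 0) :
    ccwGap u.arg w.arg < π ↔ 0 < crossProd u w := by
  rw [crossProd_eq_norm_mul_sin,
    mul_pos_iff_of_pos_left (mul_pos (norm_pos_iff.2 hu) (norm_pos_iff.2 hw))]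
  refine ⟨sin_pos_of_pos_of_lt_pi (ccwGap_pos _ _), fun h => lt_of_not_ge fun hge => h.not_ge ?_⟩
  rw [← sin_sub_two_pi]
  exact sin_nonpos_of_nonpos_of_neg_pi_le (by linarith [ccwGap_le_two_pi u.arg w.arg])
    (by linarith)

/-- Twice the signed area of the triangle `p q r`, positive if the triangle is traversed
counterclockwise. For a fixed triangle, the numbers `triArea x q r`, `triArea p x r` and
`triArea p q x` serve as unnormalized barycentric coordinates of `x`. -/
def triArea (p q r : ℂ) : ℝ := crossProd (q - p) (r - p)

theorem triArea_rotate (p q r : ℂ) : triArea p q r = triArea q r p := by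
  simp only [triArea, crossProd, Complex.sub_re, Complex.sub_im]; ring

theorem triArea_swap (p q r : ℂ) : triArea p r q = -triArea p q r := by
  simp only [triArea, crossProd]; ring

@[simp] theorem triArea_self_left (p q : ℂ) : triArea p p q = 0 := by simp [triArea, crossProd]

@[simp] theorem triArea_self_right (p q : ℂ) : triArea p q q = 0 := by
  simp [triArea, crossProd, mul_comm]

@[simp] theorem triArea_self_outer (p q : ℂ) : triArea p q p = 0 := by simp [triArea, crossProd]

theorem triArea_add_triArea_add_triArea (p q r x : ℂ) :
    triArea x q r + triArea p x r + triArea p q x = triArea p q r := by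
  simp only [triArea, crossProd, Complex.sub_re, Complex.sub_im]; ring

theorem triArea_lineMap_right (p q x y : ℂ) (t : ℝ) : triArea p q (lineMap x y t) =
    triArea p q x + t * (triArea p q y - triArea p q x) := by
  simp only [triArea, crossProd, lineMap_apply_module', Complex.sub_re, Complex.sub_im,
    Complex.add_re, Complex.add_im, Complex.smul_re, Complex.smul_im, smul_eq_mul]
  ring

theorem triArea_lineMap_left (q r x y : ℂ) (t : ℝ) : triArea (lineMap x y t) q r =
    triArea x q r + t * (triArea y q r - triArea x q r) := by
  simpa only [triArea_rotate _ q r] using triArea_lineMap_right q r x y t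

theorem triArea_lineMap_middle (p r x y : ℂ) (t : ℝ) : triArea p (lineMap x y t) r =
    triArea p x r + t * (triArea p y r - triArea p x r) := by
  simpa only [triArea_rotate _ _ r, triArea_rotate _ r p] using triArea_lineMap_left r p x y t

/-- `x` lies in the closed triangle `p q r`, provided this triangle is traversed
counterclockwise. -/
structure InTriangle (p q r x : ℂ) : Prop where
  left : 0 ≤ triArea x q r
  middle : 0 ≤ triArea p x r
  right : 0 ≤ triArea p q x

theorem InTriangle.rotate {p q r x : ℂ} (h : InTriangle p q r x) : InTriangle q r p x :=
  ⟨triArea_rotate p x r ▸ h.middle, triArea_rotate p q x ▸ h.right, triArea_rotate x q r ▸ h.left⟩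

theorem InTriangle.mem_segment {p q r x : ℂ} (hpos : 0 < triArea p q r)
    (h : InTriangle p q r x) (h0 : triArea p q x = 0) : x ∈ segment ℝ p q := by
  have hsum := triArea_add_triArea_add_triArea p q r x
  rw [h0, add_zero] at hsum
  refine ⟨triArea x q r / triArea p q r, triArea p x r / triArea p q r, div_nonneg h.left hpos.le,
    div_nonneg h.middle hpos.le, by rw [← add_div, hsum, div_self hpos.ne'], ?_⟩
  have hbary : triArea x q r • p + triArea p x r • q + triArea p q x • r = triArea p q r • x := by
    apply Complex.ext <;> simp [triArea, crossProd] <;> ring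
  rw [h0, zero_smul, add_zero] at hbary
  rw [div_eq_inv_mul, div_eq_inv_mul, mul_smul, mul_smul, ← smul_add, hbary,
    inv_smul_smul₀ hpos.ne']

theorem exists_mem_Ioo_min_eq_zero {s t s' t' : ℝ} (hs : 0 < s) (ht : 0 < t)
    (h : ¬(0 ≤ s' ∧ 0 ≤ t')) :
    ∃ r ∈ Set.Ioo (0 : ℝ) 1, min (s + r * (s' - s)) (t + r * (t' - t)) = 0 := by
  refine intermediate_value_Ioo' (α := ℝ) (δ := ℝ)
    (f := fun r => min (s + r * (s' - s)) (t + r * (t' - t))) zero_le_one (by fun_prop) ⟨?_, ?_⟩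
  · simpa only [one_mul, add_sub_cancel, min_lt_iff, not_and_or, not_le] using h
  · simpa only [zero_mul, add_zero, lt_min_iff] using ⟨hs, ht⟩

theorem exists_mem_openSegment_mem_segment_of_not_inTriangle {p q r m e : ℂ}
    (hpos : 0 < triArea p q r) (hleft : 0 ≤ triArea m q r) (hmiddle : 0 < triArea p m r)
    (hright : 0 < triArea p q m) (hle : triArea m q r ≤ triArea e q r)
    (he : ¬InTriangle p q r e) :
    ∃ x ∈ openSegment ℝ m e, x ∈ segment ℝ p q ∨ x ∈ segment ℝ r p := by
  -- The segment leaves the cone at `p` where the smaller of the two positive coordinates vanishes.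
  obtain ⟨t, ht, hmin⟩ := exists_mem_Ioo_min_eq_zero hmiddle hright
    fun h => he ⟨hleft.trans hle, h.1, h.2⟩
  rw [← triArea_lineMap_middle, ← triArea_lineMap_right] at hmin
  refine ⟨lineMap m e t, openSegment_eq_image_lineMap ℝ m e ▸ Set.mem_image_of_mem _ ht, ?_⟩
  have hin : InTriangle p q r (lineMap m e t) := by
    refine ⟨?_, hmin ▸ min_le_left _ _, hmin ▸ min_le_right _ _⟩
    rw [triArea_lineMap_left]
    exact add_nonneg hleft (mul_nonneg ht.1.le (sub_nonneg.2 hle))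
  rcases min_choice (triArea p (lineMap m e t) r) (triArea p q (lineMap m e t)) with h | h <;>
    rw [h] at hmin
  · rw [triArea_rotate, triArea_rotate] at hmin
    rw [triArea_rotate, triArea_rotate] at hpos
    exact Or.inr (hin.rotate.rotate.mem_segment hpos hmin)
  · exact Or.inl (hin.mem_segment hpos hmin)

end Area

section Drawing

open Real AffineMap

/-- A straight-line drawing of a graph, with vertices at distinct points, whose edges meet only at
common ends. -/
structure IsPlaneDrawing {V : Type*} (z : V → ℂ) (H : SimpleGraph V) : Prop where
  injective : Function.Injective z
  vertex : ∀ u v w, H.Adj u v → z w ∉ openSegment ℝ (z u) (z v)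
  edges : ∀ u v x y, H.Adj u v → H.Adj x y → s(u, v) ≠ s(x, y) →
    Disjoint (openSegment ℝ (z u) (z v)) (openSegment ℝ (z x) (z y))

variable {V : Type*} {z : V → ℂ} {H : SimpleGraph V}

theorem mem_segment_iff_eq_or_eq_or_mem_openSegment {p q x : ℂ} :
    x ∈ segment ℝ p q ↔ x = p ∨ x = q ∨ x ∈ openSegment ℝ p q := by
  rw [← insert_endpoints_openSegment, Set.mem_insert_iff, Set.mem_insert_iff]

namespace IsPlaneDrawing

theorem mono {H' : SimpleGraph V} (h : IsPlaneDrawing z H) (hle : H' ≤ H) :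
    IsPlaneDrawing z H' :=
  ⟨h.injective, fun u v w huv => h.vertex u v w (hle huv),
    fun u v x y huv hxy => h.edges u v x y (hle huv) (hle hxy)⟩

theorem notMem_segment (h : IsPlaneDrawing z H) {v a x y : V} (hva : H.Adj v a)
    (hxy : H.Adj x y) (hne : s(x, y) ≠ s(v, a)) {q : ℂ} (hq : q ∈ openSegment ℝ (z x) (z y)) :
    q ∉ segment ℝ (z v) (z a) := by
  rw [mem_segment_iff_eq_or_eq_or_mem_openSegment]
  rintro (rfl | rfl | hq')
  exacts [h.vertex x y v hxy hq, h.vertex x y a hxy hq,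
    Set.disjoint_left.1 (h.edges x y v a hxy hva hne) hq hq']

theorem eq_of_sameRay (h : IsPlaneDrawing z H) {v a p : V} (hva : H.Adj v a) (hvp : v ≠ p)
    (hfree : ∀ w, z w ∉ openSegment ℝ (z v) (z p))
    (hray : SameRay ℝ (z a - z v) (z p - z v)) : a = p := by
  rcases wbtw_total_of_sameRay_vsub_left (R := ℝ) (P := ℂ) hray with hb | hb <;>
    rw [← mem_segment_iff_wbtw, mem_segment_iff_eq_or_eq_or_mem_openSegment] at hb <;>
    rcases hb with hb | hb | hb
  exacts [absurd (h.injective hb).symm hva.ne, h.injective hb, absurd hb (hfree a),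
    absurd (h.injective hb).symm hvp, (h.injective hb).symm, absurd hb (h.vertex v a p hva)]

theorem eq_of_mem_openSegment (h : IsPlaneDrawing z H) {v a p : V} (hva : H.Adj v a)
    (hvp : v ≠ p) (hfree : ∀ w, z w ∉ openSegment ℝ (z v) (z p)) {m : ℂ}
    (hma : m ∈ openSegment ℝ (z v) (z a)) (hmp : m ∈ openSegment ℝ (z v) (z p)) : a = p := by
  refine h.eq_of_sameRay hva hvp hfree ?_
  rw [openSegment_eq_image'] at hma hmp
  obtain ⟨s, ⟨hs, -⟩, hsm⟩ := hma
  obtain ⟨t, ⟨ht, -⟩, htm⟩ := hmp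
  exact Or.inr (Or.inr ⟨s, t, hs, ht, add_left_cancel (hsm.trans htm.symm)⟩)

theorem disjoint_openSegment_sup_edge (h : IsPlaneDrawing z H) {v p : V}
    (hedge : ∀ x y, H.Adj x y → Disjoint (openSegment ℝ (z v) (z p)) (openSegment ℝ (z x) (z y)))
    {x y x' y' : V} (hxy : (H ⊔ SimpleGraph.edge v p).Adj x y)
    (hxy' : (H ⊔ SimpleGraph.edge v p).Adj x' y') (hne : s(x, y) ≠ s(x', y')) :
    Disjoint (openSegment ℝ (z x) (z y)) (openSegment ℝ (z x') (z y')) := by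
  have hnew {x y : V} (hxy : (SimpleGraph.edge v p).Adj x y) :
      s(v, p) = s(x, y) ∧ openSegment ℝ (z v) (z p) = openSegment ℝ (z x) (z y) := by
    obtain ⟨⟨rfl, rfl⟩ | ⟨rfl, rfl⟩, -⟩ := (SimpleGraph.edge_adj ..).1 hxy
    exacts [⟨rfl, rfl⟩, ⟨Sym2.eq_swap, openSegment_symm ..⟩]
  rcases hxy with hxy | hxy <;> rcases hxy' with hxy' | hxy'
  · exact h.edges x y x' y' hxy hxy' hne
  · exact (hnew hxy').2 ▸ (hedge x y hxy).symm
  · exact (hnew hxy).2 ▸ hedge x' y' hxy'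
  · exact absurd ((hnew hxy).1.symm.trans (hnew hxy').1) hne

theorem sup_edge (h : IsPlaneDrawing z H) {v p : V}
    (hfree : ∀ w, z w ∉ openSegment ℝ (z v) (z p))
    (hedge : ∀ x y, H.Adj x y → Disjoint (openSegment ℝ (z v) (z p)) (openSegment ℝ (z x) (z y))) :
    IsPlaneDrawing z (H ⊔ SimpleGraph.edge v p) := by
  refine ⟨h.injective, fun x y w hxy => ?_,
    fun _ _ _ _ => h.disjoint_openSegment_sup_edge hedge⟩
  rw [SimpleGraph.sup_adj, SimpleGraph.edge_adj] at hxy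
  rcases hxy with hxy | ⟨⟨rfl, rfl⟩ | ⟨rfl, rfl⟩, -⟩
  exacts [h.vertex x y w hxy, hfree w, openSegment_symm ℝ (z y) (z x) ▸ hfree w]

end IsPlaneDrawing

theorem adj_of_maximal (h : Maximal (IsPlaneDrawing z) H) {v p : V} (hvp : v ≠ p)
    (hfree : ∀ w, z w ∉ openSegment ℝ (z v) (z p))
    (hedge : ∀ x y, H.Adj x y → Disjoint (openSegment ℝ (z v) (z p)) (openSegment ℝ (z x) (z y))) :
    H.Adj v p :=
  h.le_of_ge (h.prop.sup_edge hfree hedge) le_sup_left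
    (Or.inr ((SimpleGraph.edge_adj ..).2 ⟨Or.inl ⟨rfl, rfl⟩, hvp⟩))

/-- Two edges `va` and `vb` that bound a corner at `v`, from `a` counterclockwise to `b`, of angle
less than `π`, with no further edge at `v` inside the corner. -/
structure EmptyCorner (z : V → ℂ) (H : SimpleGraph V) (v a b : V) : Prop where
  adj_left : H.Adj v a
  adj_right : H.Adj v b
  pos : 0 < triArea (z v) (z a) (z b)
  empty : ∀ d, H.Adj v d → 0 < triArea (z v) (z a) (z d) → triArea (z v) (z d) (z b) ≤ 0

namespace EmptyCorner

variable {v a b : V}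

theorem inTriangle_of_adj (hc : EmptyCorner z H v a b) (h : IsPlaneDrawing z H) {x y : V} {m : ℂ}
    (hxy : H.Adj x y) (hm : m ∈ openSegment ℝ (z x) (z y)) (hleft : 0 ≤ triArea m (z a) (z b))
    (hmiddle : 0 < triArea (z v) m (z b)) (hright : 0 < triArea (z v) (z a) m)
    (hle : triArea m (z a) (z b) ≤ triArea (z x) (z a) (z b)) :
    x ≠ v ∧ InTriangle (z v) (z a) (z b) (z x) := by
  obtain ⟨t, ht, rfl⟩ := openSegment_eq_image_lineMap ℝ (z x) (z y) ▸ hm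
  have hmL := triArea_lineMap_middle (z v) (z b) (z x) (z y) t
  have hmR := triArea_lineMap_right (z v) (z a) (z x) (z y) t
  constructor
  · rintro rfl
    simp only [triArea_self_left, triArea_self_outer, zero_add, sub_zero] at hmL hmR
    rw [hmL] at hmiddle
    rw [hmR] at hright
    exact (pos_of_mul_pos_right hmiddle ht.1.le).not_ge
      (hc.empty y hxy (pos_of_mul_pos_right hright ht.1.le))
  · by_contra hout
    obtain ⟨q, hq, hq'⟩ := exists_mem_openSegment_mem_segment_of_not_inTriangle hc.pos hleft
      hmiddle hright hle hout
    have hqxy : q ∈ openSegment ℝ (z x) (z y) := by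
      rw [openSegment_symm, openSegment_eq_image_lineMap] at hq
      obtain ⟨s, hs, rfl⟩ := hq
      rw [lineMap_lineMap_right, openSegment_eq_image_lineMap]
      exact Set.mem_image_of_mem _ ⟨mul_pos hs.1 ht.1, mul_lt_one_of_nonneg_of_lt_one_left
        hs.1.le hs.2 ht.2.le⟩
    have hne_left : s(x, y) ≠ s(v, a) := by
      intro heq
      rcases Sym2.eq_iff.1 heq with ⟨rfl, rfl⟩ | ⟨rfl, rfl⟩ <;>
        simp [hmR] at hright
    have hne_right : s(x, y) ≠ s(b, v) := by
      intro heq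
      rcases Sym2.eq_iff.1 heq with ⟨rfl, rfl⟩ | ⟨rfl, rfl⟩ <;>
        simp [hmL] at hmiddle
    exact hq'.elim (h.notMem_segment hc.adj_left hxy hne_left hqxy)
      (h.notMem_segment hc.adj_right.symm hxy hne_right hqxy)

theorem exists_end_inTriangle (hc : EmptyCorner z H v a b) (h : IsPlaneDrawing z H) {x y : V}
    {m : ℂ} (hxy : H.Adj x y) (hm : m ∈ openSegment ℝ (z x) (z y))
    (hleft : 0 ≤ triArea m (z a) (z b)) (hmiddle : 0 < triArea (z v) m (z b))
    (hright : 0 < triArea (z v) (z a) m) :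
    ∃ x y, H.Adj x y ∧ m ∈ openSegment ℝ (z x) (z y) ∧ x ≠ v ∧
      InTriangle (z v) (z a) (z b) (z x) ∧ triArea m (z a) (z b) ≤ triArea (z x) (z a) (z b) := by
  wlog hle : triArea m (z a) (z b) ≤ triArea (z x) (z a) (z b) generalizing x y
  · refine this hxy.symm (openSegment_symm ℝ (z x) (z y) ▸ hm) ?_
    obtain ⟨t, ht, rfl⟩ := openSegment_eq_image_lineMap ℝ (z x) (z y) ▸ hm
    rw [triArea_lineMap_left] at hle ⊢
    nlinarith [ht.1, ht.2]
  obtain ⟨hxv, hx⟩ := hc.inTriangle_of_adj h hxy hm hleft hmiddle hright hle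
  exact ⟨x, y, hxy, hm, hxv, hx, hle⟩

theorem pos_of_inTriangle (hc : EmptyCorner z H v a b) (h : IsPlaneDrawing z H) {p : V}
    (hpv : p ≠ v) (hpa : p ≠ a) (hpb : p ≠ b) (hp : InTriangle (z v) (z a) (z b) (z p)) :
    0 < triArea (z v) (z p) (z b) ∧ 0 < triArea (z v) (z a) (z p) := by
  have hpos := hc.pos
  constructor
  · refine hp.middle.lt_of_ne' fun h0 => ?_
    rw [triArea_rotate, triArea_rotate] at h0 hpos
    rcases mem_segment_iff_eq_or_eq_or_mem_openSegment.1
      (hp.rotate.rotate.mem_segment hpos h0) with hpq | hpq | hpq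
    exacts [hpb (h.injective hpq), hpv (h.injective hpq), h.vertex b v p hc.adj_right.symm hpq]
  · refine hp.right.lt_of_ne' fun h0 => ?_
    rcases mem_segment_iff_eq_or_eq_or_mem_openSegment.1
      (hp.mem_segment hpos h0) with hpq | hpq | hpq
    exacts [hpv (h.injective hpq), hpa (h.injective hpq), h.vertex v a p hc.adj_left hpq]

section Finite

variable [Finite V] (hc : EmptyCorner z H v a b) (h : Maximal (IsPlaneDrawing z) H)
include hc h

theorem eq_of_inTriangle {p : V} (hp : InTriangle (z v) (z a) (z b) (z p)) :
    p = v ∨ p = a ∨ p = b := by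
  by_contra! hne
  -- Of all further vertices in the triangle, one farthest from the side `ab` is visible from `v`.
  obtain ⟨p, ⟨⟨hpv, hpa, hpb⟩, hp⟩, hmax⟩ := Set.exists_max_image
    {p | (p ≠ v ∧ p ≠ a ∧ p ≠ b) ∧ InTriangle (z v) (z a) (z b) (z p)}
    (fun p => triArea (z p) (z a) (z b)) (Set.toFinite _) ⟨p, hne, hp⟩
  obtain ⟨hpL, hpR⟩ := hc.pos_of_inTriangle h.prop hpv hpa hpb hp
  have hbary := triArea_add_triArea_add_triArea (z v) (z a) (z b) (z p)
  have hfar {m : ℂ} (hm : m ∈ openSegment ℝ (z v) (z p)) :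
      triArea (z p) (z a) (z b) < triArea m (z a) (z b) ∧ 0 < triArea (z v) m (z b) ∧
        0 < triArea (z v) (z a) m := by
    obtain ⟨t, ⟨ht0, ht1⟩, rfl⟩ := openSegment_eq_image_lineMap ℝ (z v) (z p) ▸ hm
    rw [triArea_lineMap_left, triArea_lineMap_middle, triArea_lineMap_right, triArea_self_left,
      triArea_self_outer, zero_add, zero_add, sub_zero, sub_zero]
    exact ⟨by nlinarith, mul_pos ht0 hpL, mul_pos ht0 hpR⟩
  have hvp : H.Adj v p := by
    refine adj_of_maximal h hpv.symm (fun w hw => ?_) fun x y hxy => Set.disjoint_left.2 ?_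
    · obtain ⟨hlt, hwL, hwR⟩ := hfar hw
      refine hlt.not_ge (hmax w ⟨⟨?_, ?_, ?_⟩, hp.left.trans hlt.le, hwL.le, hwR.le⟩) <;> rintro rfl
      exacts [by simp at hwL, by simp at hwR, by simp at hwL]
    · intro m hm hmxy
      obtain ⟨hlt, hmL, hmR⟩ := hfar hm
      obtain ⟨x, -, -, -, hxv, hx, hle⟩ :=
        hc.exists_end_inTriangle h.prop hxy hmxy (hp.left.trans hlt.le) hmL hmR
      refine (hlt.trans_le hle).not_ge (hmax x ⟨⟨hxv, ?_, ?_⟩, hx⟩) <;> rintro rfl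
      · rw [triArea_self_left] at hle; linarith [hp.left]
      · rw [triArea_self_outer] at hle; linarith [hp.left]
  exact hpL.not_ge (hc.empty p hvp hpR)

theorem adj : H.Adj a b := by
  by_contra hnadj
  have hpos := hc.pos
  have hab : a ≠ b := by rintro rfl; simp at hpos
  have hside {m : ℂ} (hm : m ∈ openSegment ℝ (z a) (z b)) :
      triArea m (z a) (z b) = 0 ∧ 0 < triArea (z v) m (z b) ∧ 0 < triArea (z v) (z a) m := by
    obtain ⟨t, ⟨ht0, ht1⟩, rfl⟩ := openSegment_eq_image_lineMap ℝ (z a) (z b) ▸ hm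
    rw [triArea_lineMap_left, triArea_lineMap_middle, triArea_lineMap_right]
    simp only [triArea_self_left, triArea_self_outer, triArea_self_right]
    exact ⟨by ring, by nlinarith, by nlinarith⟩
  have hfree (w : V) : z w ∉ openSegment ℝ (z a) (z b) := by
    intro hw
    obtain ⟨hw0, hwL, hwR⟩ := hside hw
    rcases hc.eq_of_inTriangle h ⟨hw0.ge, hwL.le, hwR.le⟩ with rfl | rfl | rfl
    exacts [by simp at hwL, by simp at hwR, by simp at hwL]
  refine hnadj (adj_of_maximal h hab hfree fun x y hxy => Set.disjoint_left.2 fun m hm hmxy => ?_)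
  obtain ⟨hm0, hmL, hmR⟩ := hside hm
  obtain ⟨x, y, hxy, hmxy, hxv, hx, -⟩ :=
    hc.exists_end_inTriangle h.prop hxy hmxy hm0.ge hmL hmR
  rcases (hc.eq_of_inTriangle h hx).resolve_left hxv with rfl | rfl
  · exact hnadj (h.prop.eq_of_mem_openSegment hxy hab hfree hmxy hm ▸ hxy)
  · rw [openSegment_symm] at hm
    refine hnadj (h.prop.eq_of_mem_openSegment hxy hab.symm (fun w => ?_) hmxy hm ▸ hxy.symm)
    rw [openSegment_symm]
    exact hfree w

theorem rotate : EmptyCorner z H a b v := by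
  have hpos := hc.pos
  refine ⟨hc.adj h, hc.adj_left.symm, triArea_rotate (z v) _ _ ▸ hpos, fun d had hA => ?_⟩
  by_contra! hR
  rw [triArea_rotate, triArea_rotate] at hA
  rw [← triArea_rotate] at hR
  rcases le_or_gt 0 (triArea (z v) (z d) (z b)) with hL | hL
  · rcases hc.eq_of_inTriangle h ⟨hA.le, hL, hR.le⟩ with rfl | rfl | rfl
    exacts [by simp at hR, by simp at hR, by simp at hA]
  -- Otherwise the edge from `a` to `d` leaves the triangle through the side from `v` to `b`.
  set t := triArea (z v) (z a) (z b) / (triArea (z v) (z a) (z b) - triArea (z v) (z d) (z b))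
    with ht
  have hden : 0 < triArea (z v) (z a) (z b) - triArea (z v) (z d) (z b) := by linarith
  have ht0 : 0 < t := div_pos hpos hden
  have hq : lineMap (z a) (z d) t ∈ openSegment ℝ (z a) (z d) :=
    openSegment_eq_image_lineMap ℝ (z a) (z d) ▸
      Set.mem_image_of_mem _ ⟨ht0, (div_lt_one hden).2 (by linarith)⟩
  have hqL : triArea (z v) (lineMap (z a) (z d) t) (z b) = 0 := by
    rw [triArea_lineMap_middle, ht]; field_simp; ring
  have hin : InTriangle (z v) (z a) (z b) (lineMap (z a) (z d) t) := by
    refine ⟨?_, hqL.ge, ?_⟩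
    · rw [triArea_lineMap_left, triArea_self_left, zero_add, sub_zero]; positivity
    · rw [triArea_lineMap_right, triArea_self_right, zero_add, sub_zero]; positivity
  rw [triArea_rotate, triArea_rotate] at hqL hpos
  refine h.prop.notMem_segment hc.adj_right.symm had (fun heq => ?_) hq
    (hin.rotate.rotate.mem_segment hpos hqL)
  rcases Sym2.eq_iff.1 heq with ⟨rfl, rfl⟩ | ⟨rfl, rfl⟩ <;> simp at hpos

end Finite

end EmptyCorner

end Drawing

section Corners

open Real

variable {V : Type*}

/-- The direction in which `a` is seen from `v`. -/
noncomputable def dirArg (z : V → ℂ) (v a : V) : Real.Angle := (z a - z v).arg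

theorem dirArg_eq_dirArg_add_pi {z : V → ℂ} (hz : Function.Injective z) {v a : V} (hva : v ≠ a) :
    dirArg z v a = dirArg z a v + π := by
  rw [dirArg, dirArg, ← Complex.arg_neg_coe_angle (sub_ne_zero.2 (hz.ne hva)), neg_sub]

theorem ccwGap_dirArg_lt_pi_iff {z : V → ℂ} (hz : Function.Injective z) {v a b : V}
    (hva : v ≠ a) (hvb : v ≠ b) :
    ccwGap (dirArg z v a) (dirArg z v b) < π ↔ 0 < triArea (z v) (z a) (z b) :=
  ccwGap_arg_lt_pi_iff (sub_ne_zero.2 (hz.ne hva.symm)) (sub_ne_zero.2 (hz.ne hvb.symm))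

theorem sum_ccwGap_triangle {z : V → ℂ} (hz : Function.Injective z) {v a b : V} (hva : v ≠ a)
    (hab : a ≠ b) (hbv : b ≠ v) (hpos : 0 < triArea (z v) (z a) (z b)) :
    ccwGap (dirArg z v a) (dirArg z v b) + ccwGap (dirArg z a b) (dirArg z a v) +
      ccwGap (dirArg z b v) (dirArg z b a) = π := by
  have hv := (ccwGap_dirArg_lt_pi_iff hz hva hbv.symm).2 hpos
  rw [triArea_rotate] at hpos
  have ha := (ccwGap_dirArg_lt_pi_iff hz hab hva.symm).2 hpos
  rw [triArea_rotate] at hpos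
  have hb := (ccwGap_dirArg_lt_pi_iff hz hbv hab.symm).2 hpos
  have hcoe : ((ccwGap (dirArg z v a) (dirArg z v b) + ccwGap (dirArg z a b) (dirArg z a v) +
      ccwGap (dirArg z b v) (dirArg z b a) : ℝ) : Real.Angle) = (π : ℝ) := by
    rw [Angle.coe_add, Angle.coe_add, coe_ccwGap, coe_ccwGap, coe_ccwGap,
      dirArg_eq_dirArg_add_pi hz hva, dirArg_eq_dirArg_add_pi hz hab,
      dirArg_eq_dirArg_add_pi hz hbv]
    calc _ = -((π : Real.Angle) + π) + -π := by abel
      _ = π := by rw [Angle.coe_pi_add_coe_pi, neg_zero, zero_add, Angle.neg_coe_pi]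
  obtain ⟨k, hk⟩ := Angle.angle_eq_iff_two_pi_dvd_sub.1 hcoe
  have hk_lt : (k : ℝ) < 1 := by nlinarith [pi_pos]
  have hk_gt : (-1 : ℝ) < k := by
    nlinarith [pi_pos, ccwGap_pos (dirArg z v a) (dirArg z v b),
      ccwGap_pos (dirArg z a b) (dirArg z a v), ccwGap_pos (dirArg z b v) (dirArg z b a)]
  obtain rfl : k = 0 := by
    have : k < 1 := by exact_mod_cast hk_lt
    have : -1 < k := by exact_mod_cast hk_gt
    lia
  simpa [sub_eq_zero] using hk

variable [Fintype V]

open Classical in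
/-- The neighbours of `v`. -/
noncomputable def nbrs (H : SimpleGraph V) (v : V) : Finset V := {a | H.Adj v a}

@[simp] theorem mem_nbrs {H : SimpleGraph V} {v a : V} : a ∈ nbrs H v ↔ H.Adj v a := by
  simp [nbrs]

/-- The neighbour of `v` that follows `a` counterclockwise. -/
noncomputable def nextNbr (z : V → ℂ) (H : SimpleGraph V) (v a : V) : V :=
  nextDir (dirArg z v) (nbrs H v) a

/-- The angle at `v` between `a` and the neighbour following it counterclockwise. -/
noncomputable def corner (z : V → ℂ) (H : SimpleGraph V) (v a : V) : ℝ :=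
  cornerAngle (dirArg z v) (nbrs H v) a

/-- The dart (oriented edge) preceding `p` on the boundary of the region to the left of `p`. -/
noncomputable def prevDart (z : V → ℂ) (H : SimpleGraph V) (p : V × V) : V × V :=
  (nextNbr z H p.1 p.2, p.1)

variable {z : V → ℂ} {H : SimpleGraph V} {v a b : V}

theorem corner_eq (z : V → ℂ) (H : SimpleGraph V) (v a : V) :
    corner z H v a = ccwGap (dirArg z v a) (dirArg z v (nextNbr z H v a)) := rfl

theorem corner_pos (z : V → ℂ) (H : SimpleGraph V) (v a : V) : 0 < corner z H v a :=
  ccwGap_pos _ _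

theorem nextNbr_adj (h : H.Adj v a) : H.Adj v (nextNbr z H v a) :=
  mem_nbrs.1 (nextDir_mem ⟨a, mem_nbrs.2 h⟩ a)

theorem prevDart_adj {p : V × V} (hp : H.Adj p.1 p.2) :
    H.Adj (prevDart z H p).1 (prevDart z H p).2 :=
  (nextNbr_adj hp).symm

theorem IsPlaneDrawing.dirArg_injOn_nbrs (h : IsPlaneDrawing z H) (v : V) :
    Set.InjOn (dirArg z v) (nbrs H v) := by
  intro a ha b hb hab
  rw [SetLike.mem_coe, mem_nbrs] at ha hb
  refine h.eq_of_sameRay ha hb.ne (fun w => h.vertex v b w hb) (Complex.sameRay_iff.2 ?_)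
  exact Or.inr (Or.inr (Complex.arg_coe_angle_eq_iff.1 hab))

theorem IsPlaneDrawing.prevDart_injOn (h : IsPlaneDrawing z H) :
    Set.InjOn (prevDart z H) {p | H.Adj p.1 p.2} := by
  rintro ⟨v, a⟩ ha ⟨w, b⟩ hb hab
  obtain ⟨hnext, rfl : v = w⟩ := Prod.ext_iff.1 hab
  exact Prod.ext rfl
    (nextDir_injOn (h.dirArg_injOn_nbrs v) (mem_nbrs.2 ha) (mem_nbrs.2 hb) hnext)

theorem EmptyCorner.nextNbr_eq (hc : EmptyCorner z H v a b) (h : IsPlaneDrawing z H) :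
    nextNbr z H v a = b := by
  refine nextDir_eq_of_forall_le (h.dirArg_injOn_nbrs v) (mem_nbrs.2 hc.adj_right) fun d hd => ?_
  rw [mem_nbrs] at hd
  by_contra! hlt
  have hadd := ccwGap_add_of_lt hlt
  have hab := (ccwGap_dirArg_lt_pi_iff h.injective hc.adj_left.ne hc.adj_right.ne).2 hc.pos
  have had := (ccwGap_dirArg_lt_pi_iff h.injective hc.adj_left.ne hd.ne).1 (hlt.trans hab)
  refine (hc.empty d hd had).not_gt
    ((ccwGap_dirArg_lt_pi_iff h.injective hd.ne hc.adj_right.ne).1 ?_)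
  linarith [ccwGap_pos (dirArg z v a) (dirArg z v d)]

theorem corner_lt_pi_iff (hz : Function.Injective z) (ha : H.Adj v a) :
    corner z H v a < π ↔ 0 < triArea (z v) (z a) (z (nextNbr z H v a)) :=
  ccwGap_dirArg_lt_pi_iff hz ha.ne (nextNbr_adj ha).ne

theorem EmptyCorner.corner_lt_pi (hc : EmptyCorner z H v a b) (h : IsPlaneDrawing z H) :
    corner z H v a < π := by
  rw [corner_lt_pi_iff h.injective hc.adj_left, hc.nextNbr_eq h]
  exact hc.pos

theorem emptyCorner_of_corner_lt_pi (hz : Function.Injective z) (ha : H.Adj v a)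
    (hlt : corner z H v a < π) : EmptyCorner z H v a (nextNbr z H v a) := by
  have hb : H.Adj v (nextNbr z H v a) := nextNbr_adj ha
  refine ⟨ha, hb, (corner_lt_pi_iff hz ha).1 hlt, fun d hd had => ?_⟩
  have hadπ := (ccwGap_dirArg_lt_pi_iff hz ha.ne hd.ne).2 had
  rcases (cornerAngle_le (α := dirArg z v) a (mem_nbrs.2 hd)).lt_or_eq with hgap | hgap
  · have hadd := ccwGap_add_of_lt hgap
    have hbd := (ccwGap_dirArg_lt_pi_iff hz hb.ne hd.ne).1
      (lt_of_le_of_lt (hadd ▸ le_add_of_nonneg_left (corner_pos z H v a).le) hadπ)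
    rw [triArea_swap]
    linarith
  · have hdir : dirArg z v (nextNbr z H v a) = dirArg z v d := ccwGap_right_injective _ hgap
    refine le_of_not_gt fun hdb => ?_
    have := (ccwGap_dirArg_lt_pi_iff hz hd.ne hb.ne).2 hdb
    rw [hdir, ccwGap_self] at this
    linarith [pi_pos]

end Corners

section Regions

open Real

variable {V X : Type*} [Fintype V]

open Classical in
/-- The darts of `H` which the labelling `ρ` of darts by regions assigns to the region `L`. -/
noncomputable def labelDarts (H : SimpleGraph V) (ρ : V × V → Option X) (L : Option X) :
    Finset (V × V) :=
  {p | H.Adj p.1 p.2 ∧ ρ p = L}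

@[simp] theorem mem_labelDarts {H : SimpleGraph V} {ρ : V × V → Option X} {L : Option X}
    {p : V × V} : p ∈ labelDarts H ρ L ↔ H.Adj p.1 p.2 ∧ ρ p = L := by
  simp [labelDarts]

/-- The total turning angle along the boundary of the region `L`. -/
noncomputable def turning (z : V → ℂ) (H : SimpleGraph V) (ρ : V × V → Option X)
    (L : Option X) : ℝ :=
  ∑ p ∈ labelDarts H ρ L, (π - corner z H p.1 p.2)

/-- Twice the signed area enclosed by the boundary of the region `L`. -/
noncomputable def doubleArea (z : V → ℂ) (H : SimpleGraph V) (ρ : V × V → Option X)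
    (L : Option X) : ℝ :=
  ∑ p ∈ labelDarts H ρ L, crossProd (z p.1) (z p.2)

/-- A labelling of the darts of a plane drawing by the region to their left, with `none` standing
for the outer region. The regions are known only through the turning and the area of their
boundaries; this replaces both the Jordan curve theorem and Euler's formula. -/
structure RegionLabelling (z : V → ℂ) (H : SimpleGraph V) (ρ : V × V → Option X) : Prop
    extends IsPlaneDrawing z H where
  label_prevDart : ∀ p : V × V, H.Adj p.1 p.2 → ρ (prevDart z H p) = ρ p
  turning_inner : ∀ x, (labelDarts H ρ (some x)).Nonempty →
    ∃ τ : ℤ, τ ≤ 1 ∧ turning z H ρ (some x) = 2 * π * τ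
  area_inner : ∀ x, (labelDarts H ρ (some x)).Nonempty → 0 < doubleArea z H ρ (some x)
  turning_outer : turning z H ρ none ≤ 0

open Classical in
/-- The darts of the triangle with vertices `v`, `a`, `b`, in this cyclic order. -/
noncomputable def triangleDarts (v a b : V) : Finset (V × V) := {(v, a), (a, b), (b, v)}

omit [Fintype V] in
theorem mem_triangleDarts {v a b : V} {p : V × V} :
    p ∈ triangleDarts v a b ↔ p = (v, a) ∨ p = (a, b) ∨ p = (b, v) := by
  simp [triangleDarts]

omit [Fintype V] in
theorem triangleDarts_rotate (v a b : V) : triangleDarts a b v = triangleDarts v a b := by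
  ext p
  simp only [mem_triangleDarts]
  tauto

omit [Fintype V] in
theorem sum_triangleDarts {v a b : V} (hva : v ≠ a) (hab : a ≠ b) (hbv : b ≠ v)
    (F : V × V → ℝ) : ∑ p ∈ triangleDarts v a b, F p = F (v, a) + F (a, b) + F (b, v) := by
  classical
  rw [triangleDarts, Finset.sum_insert, Finset.sum_pair, add_assoc]
  · simp [hab]
  · simp [hva, hbv.symm]

/-- The labelling of the darts of a maximal plane drawing by the triangle to their left. -/
noncomputable def triangleLabel (z : V → ℂ) (H : SimpleGraph V) (p : V × V) :
    Option (Finset (V × V)) :=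
  if corner z H p.1 p.2 < π then some (triangleDarts p.1 p.2 (nextNbr z H p.1 p.2)) else none

variable {z : V → ℂ} {H : SimpleGraph V} {v a b : V}

theorem triangleLabel_eq_none_iff {p : V × V} :
    triangleLabel z H p = none ↔ π ≤ corner z H p.1 p.2 := by
  simp [triangleLabel]

theorem mem_of_triangleLabel_eq_some {p : V × V} {T : Finset (V × V)}
    (hp : triangleLabel z H p = some T) : p ∈ T := by
  rw [triangleLabel] at hp
  split_ifs at hp
  rw [← Option.some.inj hp, mem_triangleDarts]
  exact Or.inl rfl

theorem EmptyCorner.triangleLabel_eq (hc : EmptyCorner z H v a b) (h : IsPlaneDrawing z H) :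
    triangleLabel z H (v, a) = some (triangleDarts v a b) := by
  rw [triangleLabel, if_pos (hc.corner_lt_pi h), hc.nextNbr_eq h]

theorem EmptyCorner.corner_eq (hc : EmptyCorner z H v a b) (h : IsPlaneDrawing z H) :
    corner z H v a = ccwGap (dirArg z v a) (dirArg z v b) := by
  rw [_root_.corner_eq, hc.nextNbr_eq h]

theorem EmptyCorner.labelDarts_triangleLabel (hc : EmptyCorner z H v a b)
    (h : Maximal (IsPlaneDrawing z) H) :
    labelDarts H (triangleLabel z H) (some (triangleDarts v a b)) = triangleDarts v a b := by
  have hca := hc.rotate h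
  have hcb := hca.rotate h
  ext p
  rw [mem_labelDarts]
  refine ⟨fun hp => mem_of_triangleLabel_eq_some hp.2, fun hp => ?_⟩
  rw [mem_triangleDarts] at hp
  obtain rfl | rfl | rfl := hp
  · exact ⟨hc.adj_left, hc.triangleLabel_eq h.prop⟩
  · exact ⟨hca.adj_left, by rw [hca.triangleLabel_eq h.prop, triangleDarts_rotate]⟩
  · exact ⟨hcb.adj_left, by rw [hcb.triangleLabel_eq h.prop, ← triangleDarts_rotate]⟩

theorem EmptyCorner.turning_triangleLabel (hc : EmptyCorner z H v a b)
    (h : Maximal (IsPlaneDrawing z) H) :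
    turning z H (triangleLabel z H) (some (triangleDarts v a b)) = 2 * π := by
  have hab := hc.adj h
  have hca := hc.rotate h
  have hcb := hca.rotate h
  have hz := h.prop.injective
  have hangles := sum_ccwGap_triangle hz hc.adj_left.ne hab.ne hc.adj_right.ne.symm hc.pos
  rw [turning, hc.labelDarts_triangleLabel h,
    sum_triangleDarts hc.adj_left.ne hab.ne hc.adj_right.ne.symm, hc.corner_eq h.prop,
    hca.corner_eq h.prop, hcb.corner_eq h.prop]
  linarith

theorem EmptyCorner.doubleArea_triangleLabel (hc : EmptyCorner z H v a b)
    (h : Maximal (IsPlaneDrawing z) H) :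
    doubleArea z H (triangleLabel z H) (some (triangleDarts v a b)) =
      triArea (z v) (z a) (z b) := by
  rw [doubleArea, hc.labelDarts_triangleLabel h,
    sum_triangleDarts hc.adj_left.ne (hc.adj h).ne hc.adj_right.ne.symm]
  simp only [triArea, crossProd, Complex.sub_re, Complex.sub_im]
  ring

theorem triangleLabel_prevDart (h : Maximal (IsPlaneDrawing z) H) {p : V × V}
    (hp : H.Adj p.1 p.2) : triangleLabel z H (prevDart z H p) = triangleLabel z H p := by
  have hz := h.prop.injective
  by_cases hlt : corner z H p.1 p.2 < π
  · have hc := emptyCorner_of_corner_lt_pi hz hp hlt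
    rw [prevDart, ((hc.rotate h).rotate h).triangleLabel_eq h.prop, ← triangleDarts_rotate,
      ← hc.triangleLabel_eq h.prop]
  · have hge : π ≤ corner z H (prevDart z H p).1 (prevDart z H p).2 := by
      by_contra! hlt'
      have hc := (emptyCorner_of_corner_lt_pi hz (prevDart_adj hp) hlt').rotate h
      have hprev : prevDart z H (p.1, _) = prevDart z H p := Prod.ext (hc.nextNbr_eq h.prop) rfl
      rw [← h.prop.prevDart_injOn hc.adj_left hp hprev] at hlt
      exact hlt (hc.corner_lt_pi h.prop)
    rw [triangleLabel_eq_none_iff.2 hge, triangleLabel_eq_none_iff.2 (not_lt.1 hlt)]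

theorem regionLabelling_triangleLabel (h : Maximal (IsPlaneDrawing z) H) :
    RegionLabelling z H (triangleLabel z H) := by
  have exists_emptyCorner {T} (hT : (labelDarts H (triangleLabel z H) (some T)).Nonempty) :
      ∃ v a b, EmptyCorner z H v a b ∧ T = triangleDarts v a b := by
    obtain ⟨p, hp⟩ := hT
    rw [mem_labelDarts] at hp
    have hlt : corner z H p.1 p.2 < π := by
      by_contra! hge
      simp [triangleLabel_eq_none_iff.2 hge] at hp
    have hc := emptyCorner_of_corner_lt_pi h.prop.injective hp.1 hlt
    exact ⟨_, _, _, hc, Option.some.inj (hp.2.symm.trans (hc.triangleLabel_eq h.prop))⟩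
  refine ⟨h.prop, fun p hp => triangleLabel_prevDart h hp, fun T hT => ?_, fun T hT => ?_,
    Finset.sum_nonpos fun p hp => ?_⟩
  · obtain ⟨v, a, b, hc, rfl⟩ := exists_emptyCorner hT
    exact ⟨1, le_rfl, by rw [hc.turning_triangleLabel h, Int.cast_one, mul_one]⟩
  · obtain ⟨v, a, b, hc, rfl⟩ := exists_emptyCorner hT
    rw [hc.doubleArea_triangleLabel h]
    exact hc.pos
  · exact sub_nonpos.2 (triangleLabel_eq_none_iff.1 (mem_labelDarts.1 hp).2)

end Regions

section Deletion

open Real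

variable {V X : Type*} [Fintype V] {z : V → ℂ} {H : SimpleGraph V} {ρ : V × V → Option X}
  {v w : V}

theorem nbrs_deleteEdges_left [DecidableEq V] :
    nbrs (H.deleteEdges {s(v, w)}) v = (nbrs H v).erase w := by
  ext a
  simp only [mem_nbrs, SimpleGraph.deleteEdges_adj, Set.mem_singleton_iff, Finset.mem_erase,
    Sym2.congr_right]
  tauto

theorem nbrs_deleteEdges_right [DecidableEq V] :
    nbrs (H.deleteEdges {s(v, w)}) w = (nbrs H w).erase v := by
  rw [Sym2.eq_swap, nbrs_deleteEdges_left]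

theorem nbrs_deleteEdges_of_ne {u : V} (hv : u ≠ v) (hw : u ≠ w) :
    nbrs (H.deleteEdges {s(v, w)}) u = nbrs H u := by
  ext a
  simp only [mem_nbrs, SimpleGraph.deleteEdges_adj, Set.mem_singleton_iff, Sym2.eq_iff]
  tauto

section Relabel

variable {m : Option X → Option X}

theorem RegionLabelling.label_nextDir_erase [DecidableEq V] (h : RegionLabelling z H ρ)
    (hvw : H.Adj v w) (hm : m (ρ (v, w)) = m (ρ (w, v))) {a : V}
    (ha : a ∈ (nbrs H v).erase w) :
    m (ρ (nextDir (dirArg z v) ((nbrs H v).erase w) a, v)) = m (ρ (v, a)) := by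
  have hinj := h.dirArg_injOn_nbrs v
  obtain ⟨haw, ha⟩ := Finset.mem_erase.1 ha
  have hva := h.label_prevDart (v, a) (mem_nbrs.1 ha)
  by_cases hnext : nextDir (dirArg z v) (nbrs H v) a = w
  · rw [nextDir_erase_of_eq hinj (mem_nbrs.2 hvw) ha haw hnext]
    calc m (ρ (prevDart z H (v, w))) = m (ρ (w, v)) := by
          rw [h.label_prevDart (v, w) hvw, hm]
      _ = m (ρ (prevDart z H (v, a))) := by rw [← hnext]; rfl
      _ = m (ρ (v, a)) := by rw [hva]
  · rw [nextDir_erase_of_ne hinj ha hnext]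
    exact congrArg m hva

theorem RegionLabelling.label_prevDart_deleteEdges (h : RegionLabelling z H ρ)
    (hvw : H.Adj v w) (hm : m (ρ (v, w)) = m (ρ (w, v))) {p : V × V}
    (hp : (H.deleteEdges {s(v, w)}).Adj p.1 p.2) :
    m (ρ (prevDart z (H.deleteEdges {s(v, w)}) p)) = m (ρ p) := by
  classical
  obtain ⟨u, a⟩ := p
  replace hp : a ∈ nbrs (H.deleteEdges {s(v, w)}) u := mem_nbrs.2 hp
  rw [prevDart, nextNbr]
  obtain rfl | huv := eq_or_ne u v
  · rw [nbrs_deleteEdges_left] at hp ⊢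
    exact h.label_nextDir_erase hvw hm hp
  obtain rfl | huw := eq_or_ne u w
  · rw [nbrs_deleteEdges_right] at hp ⊢
    exact h.label_nextDir_erase hvw.symm hm.symm hp
  rw [nbrs_deleteEdges_of_ne huv huw] at hp ⊢
  exact congrArg m (h.label_prevDart (u, a) (mem_nbrs.1 hp))

theorem RegionLabelling.sum_cornerAngle_erase [DecidableEq V] [DecidableEq X]
    (h : RegionLabelling z H ρ) (hvw : H.Adj v w) (hm : m (ρ (v, w)) = m (ρ (w, v)))
    (hne : ((nbrs H v).erase w).Nonempty) (L : Option X) :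
    ∑ a ∈ (nbrs H v).erase w with m (ρ (v, a)) = L,
        cornerAngle (dirArg z v) ((nbrs H v).erase w) a =
      ∑ a ∈ nbrs H v with m (ρ (v, a)) = L, cornerAngle (dirArg z v) (nbrs H v) a := by
  have hinj := h.dirArg_injOn_nbrs v
  obtain ⟨a, ha, haw⟩ := exists_nextDir_eq hinj (mem_nbrs.2 hvw)
  refine _root_.sum_cornerAngle_erase hinj (mem_nbrs.2 hvw) ha ?_ haw _ ?_
  · rintro rfl
    simp [(nextDir_eq_self_iff hinj ha).1 haw] at hne
  · rw [← h.label_prevDart (v, a) (mem_nbrs.1 ha), hm, prevDart, nextNbr, haw]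

theorem sum_labelDarts [DecidableEq X] (H : SimpleGraph V) (ρ : V × V → Option X) (L : Option X)
    (F : V × V → ℝ) :
    ∑ p ∈ labelDarts H ρ L, F p = ∑ v, ∑ a ∈ nbrs H v with ρ (v, a) = L, F (v, a) := by
  classical
  rw [labelDarts, Finset.sum_filter, Fintype.sum_prod_type]
  refine Finset.sum_congr rfl fun v _ => ?_
  rw [nbrs, Finset.filter_filter, Finset.sum_filter]
  congr!

theorem RegionLabelling.sum_corner_deleteEdges (h : RegionLabelling z H ρ) (hvw : H.Adj v w)
    (hm : m (ρ (v, w)) = m (ρ (w, v)))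
    (hne : ∀ u, (nbrs (H.deleteEdges {s(v, w)}) u).Nonempty) (L : Option X) :
    ∑ p ∈ labelDarts (H.deleteEdges {s(v, w)}) (m ∘ ρ) L,
        corner z (H.deleteEdges {s(v, w)}) p.1 p.2 =
      ∑ p ∈ labelDarts H (m ∘ ρ) L, corner z H p.1 p.2 := by
  classical
  rw [sum_labelDarts, sum_labelDarts]
  refine Finset.sum_congr rfl fun u _ => ?_
  have hu := hne u
  simp only [corner]
  obtain rfl | huv := eq_or_ne u v
  · rw [nbrs_deleteEdges_left] at hu ⊢
    exact h.sum_cornerAngle_erase hvw hm hu L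
  obtain rfl | huw := eq_or_ne u w
  · rw [nbrs_deleteEdges_right] at hu ⊢
    exact h.sum_cornerAngle_erase hvw.symm hm.symm hu L
  rw [nbrs_deleteEdges_of_ne huv huw]

end Relabel

theorem sum_labelDarts_deleteEdges [DecidableEq X] (hvw : H.Adj v w) (hρ : ρ (v, w) = ρ (w, v))
    (L : Option X) (F : V × V → ℝ) :
    ∑ p ∈ labelDarts (H.deleteEdges {s(v, w)}) ρ L, F p =
      ∑ p ∈ labelDarts H ρ L, F p - if L = ρ (v, w) then F (v, w) + F (w, v) else 0 := by
  classical
  have herase : labelDarts (H.deleteEdges {s(v, w)}) ρ L =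
      ((labelDarts H ρ L).erase (v, w)).erase (w, v) := by
    ext ⟨u, c⟩
    simp only [mem_labelDarts, SimpleGraph.deleteEdges_adj, Set.mem_singleton_iff,
      Finset.mem_erase, Sym2.eq_iff, ne_eq, Prod.mk.injEq]
    tauto
  rw [herase]
  split_ifs with hL
  · have hvw_mem : (v, w) ∈ labelDarts H ρ L := mem_labelDarts.2 ⟨hvw, hL.symm⟩
    have hwv_mem : (w, v) ∈ (labelDarts H ρ L).erase (v, w) :=
      Finset.mem_erase.2 ⟨by simp [hvw.ne'], mem_labelDarts.2 ⟨hvw.symm, (hL.trans hρ).symm⟩⟩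
    rw [← Finset.add_sum_erase _ _ hvw_mem, ← Finset.add_sum_erase _ _ hwv_mem]
    ring
  · rw [Finset.erase_eq_of_notMem, Finset.erase_eq_of_notMem, sub_zero]
    · exact fun hmem => hL (mem_labelDarts.1 hmem).2.symm
    · intro hmem
      exact hL ((hρ.trans (mem_labelDarts.1 (Finset.mem_of_mem_erase hmem)).2).symm)

theorem RegionLabelling.turning_deleteEdges [DecidableEq X] {m : Option X → Option X}
    (h : RegionLabelling z H ρ) (hvw : H.Adj v w) (hm : m (ρ (v, w)) = m (ρ (w, v)))
    (hne : ∀ u, (nbrs (H.deleteEdges {s(v, w)}) u).Nonempty) (L : Option X) :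
    turning z (H.deleteEdges {s(v, w)}) (m ∘ ρ) L =
      turning z H (m ∘ ρ) L - if L = m (ρ (v, w)) then 2 * π else 0 := by
  rw [turning, turning, Finset.sum_sub_distrib, Finset.sum_sub_distrib,
    h.sum_corner_deleteEdges hvw hm hne, sum_labelDarts_deleteEdges (ρ := m ∘ ρ) hvw hm,
    Function.comp_apply, two_mul]
  ring

theorem doubleArea_deleteEdges (hvw : H.Adj v w) (hρ : ρ (v, w) = ρ (w, v)) (L : Option X) :
    doubleArea z (H.deleteEdges {s(v, w)}) ρ L = doubleArea z H ρ L := by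
  classical
  rw [doubleArea, doubleArea, sum_labelDarts_deleteEdges hvw hρ, ← neg_crossProd (z v),
    add_neg_cancel, ite_self, sub_zero]

open Classical in
/-- The relabelling that lets the region `P` absorb the region `Q`. -/
noncomputable def mergeLabel (P Q L : Option X) : Option X := if L = Q then P else L

theorem mergeLabel_eq_left_iff {P Q L : Option X} : mergeLabel P Q L = P ↔ L = P ∨ L = Q := by
  rw [mergeLabel]
  split_ifs with hL <;> simp [hL]

theorem mergeLabel_eq_iff {P Q L K : Option X} (hKP : K ≠ P) (hKQ : K ≠ Q) :
    mergeLabel P Q L = K ↔ L = K := by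
  rw [mergeLabel]
  split_ifs with hL
  · simp [hL, hKP.symm, hKQ.symm]
  · rfl

theorem labelDarts_mergeLabel_of_ne {P Q L : Option X} (hP : L ≠ P) (hQ : L ≠ Q) :
    labelDarts H (mergeLabel P Q ∘ ρ) L = labelDarts H ρ L := by
  ext p
  simp [mergeLabel_eq_iff hP hQ]

theorem sum_labelDarts_mergeLabel_left [DecidableEq X] (P Q : Option X) (F : V × V → ℝ) :
    ∑ p ∈ labelDarts H (mergeLabel P Q ∘ ρ) P, F p =
      ∑ p ∈ labelDarts H ρ P, F p + if P = Q then 0 else ∑ p ∈ labelDarts H ρ Q, F p := by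
  classical
  have hunion : labelDarts H (mergeLabel P Q ∘ ρ) P = labelDarts H ρ P ∪ labelDarts H ρ Q := by
    ext p
    simp only [mem_labelDarts, Finset.mem_union, Function.comp_apply, mergeLabel_eq_left_iff]
    tauto
  rw [hunion]
  split_ifs with hPQ
  · rw [hPQ, Finset.union_self, add_zero]
  · refine Finset.sum_union (Finset.disjoint_left.2 fun p hP hQ => hPQ ?_)
    exact (mem_labelDarts.1 hP).2.symm.trans (mem_labelDarts.1 hQ).2

/-- The labelling in which the region to the left of the dart `(v, w)` has absorbed the region on
the other side of that edge. -/
noncomputable def mergeAcross (ρ : V × V → Option X) (v w : V) : V × V → Option X :=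
  mergeLabel (ρ (v, w)) (ρ (w, v)) ∘ ρ

omit [Fintype V] in
theorem mergeAcross_left (ρ : V × V → Option X) (v w : V) : mergeAcross ρ v w (v, w) = ρ (v, w) :=
  mergeLabel_eq_left_iff.2 (Or.inl rfl)

omit [Fintype V] in
theorem mergeAcross_right (ρ : V × V → Option X) (v w : V) : mergeAcross ρ v w (w, v) = ρ (v, w) :=
  mergeLabel_eq_left_iff.2 (Or.inr rfl)

theorem RegionLabelling.turning_mergeAcross_left [DecidableEq X] (h : RegionLabelling z H ρ)
    (hvw : H.Adj v w) (hne : ∀ u, (nbrs (H.deleteEdges {s(v, w)}) u).Nonempty) :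
    turning z (H.deleteEdges {s(v, w)}) (mergeAcross ρ v w) (ρ (v, w)) =
      turning z H ρ (ρ (v, w)) +
        (if ρ (v, w) = ρ (w, v) then 0 else turning z H ρ (ρ (w, v))) - 2 * π := by
  rw [mergeAcross, h.turning_deleteEdges hvw
    ((mergeAcross_left ρ v w).trans (mergeAcross_right ρ v w).symm) hne,
    if_pos (mergeLabel_eq_left_iff.2 (Or.inl rfl)).symm, turning, sum_labelDarts_mergeLabel_left]
  rfl

theorem RegionLabelling.turning_mergeAcross_of_ne (h : RegionLabelling z H ρ) (hvw : H.Adj v w)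
    (hne : ∀ u, (nbrs (H.deleteEdges {s(v, w)}) u).Nonempty) {L : Option X}
    (hL : L ≠ ρ (v, w)) (hL' : L ≠ ρ (w, v)) :
    turning z (H.deleteEdges {s(v, w)}) (mergeAcross ρ v w) L = turning z H ρ L := by
  classical
  rw [mergeAcross, h.turning_deleteEdges hvw
    ((mergeAcross_left ρ v w).trans (mergeAcross_right ρ v w).symm) hne,
    if_neg (fun heq => hL (heq.trans (mergeAcross_left ρ v w))), sub_zero, turning, turning,
    labelDarts_mergeLabel_of_ne hL hL']

theorem doubleArea_mergeAcross_left [DecidableEq X] (hvw : H.Adj v w) :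
    doubleArea z (H.deleteEdges {s(v, w)}) (mergeAcross ρ v w) (ρ (v, w)) =
      doubleArea z H ρ (ρ (v, w)) +
        if ρ (v, w) = ρ (w, v) then 0 else doubleArea z H ρ (ρ (w, v)) := by
  rw [doubleArea_deleteEdges hvw ((mergeAcross_left ρ v w).trans (mergeAcross_right ρ v w).symm),
    mergeAcross, doubleArea, sum_labelDarts_mergeLabel_left]
  rfl

theorem doubleArea_mergeAcross_of_ne (hvw : H.Adj v w) {L : Option X} (hL : L ≠ ρ (v, w))
    (hL' : L ≠ ρ (w, v)) :
    doubleArea z (H.deleteEdges {s(v, w)}) (mergeAcross ρ v w) L = doubleArea z H ρ L := by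
  rw [doubleArea_deleteEdges hvw ((mergeAcross_left ρ v w).trans (mergeAcross_right ρ v w).symm),
    mergeAcross, doubleArea, labelDarts_mergeLabel_of_ne hL hL', doubleArea]

theorem ne_and_nonempty_of_mergeAcross {L : Option X} (hL : L ≠ ρ (v, w))
    (hne : (labelDarts (H.deleteEdges {s(v, w)}) (mergeAcross ρ v w) L).Nonempty) :
    L ≠ ρ (w, v) ∧ (labelDarts H ρ L).Nonempty := by
  obtain ⟨p, hp⟩ := hne
  obtain ⟨hadj, hpL⟩ := mem_labelDarts.1 hp
  have hL' : L ≠ ρ (w, v) := by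
    rintro rfl
    rw [mergeAcross, Function.comp_apply, mergeLabel] at hpL
    split_ifs at hpL with hpw
    exacts [hL hpL.symm, hpw hpL]
  exact ⟨hL', p, mem_labelDarts.2 ⟨H.deleteEdges_le _ hadj, (mergeLabel_eq_iff hL hL').1 hpL⟩⟩

theorem RegionLabelling.turning_le (h : RegionLabelling z H ρ) {x : X}
    (hx : (labelDarts H ρ (some x)).Nonempty) : turning z H ρ (some x) ≤ 2 * π := by
  obtain ⟨τ, hτ, hturn⟩ := h.turning_inner x hx
  have hτ' : (τ : ℝ) ≤ 1 := by exact_mod_cast hτ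
  rw [hturn]
  exact mul_le_of_le_one_right two_pi_pos.le hτ'

theorem RegionLabelling.turning_mergeAcross_inner (h : RegionLabelling z H ρ) (hvw : H.Adj v w)
    (hout : ρ (w, v) = none → ρ (v, w) = none)
    (hne : ∀ u, (nbrs (H.deleteEdges {s(v, w)}) u).Nonempty) {x : X}
    (hx : (labelDarts (H.deleteEdges {s(v, w)}) (mergeAcross ρ v w) (some x)).Nonempty) :
    ∃ τ : ℤ, τ ≤ 1 ∧
      turning z (H.deleteEdges {s(v, w)}) (mergeAcross ρ v w) (some x) = 2 * π * τ := by
  classical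
  by_cases hP : some x = ρ (v, w)
  · obtain ⟨y, hQ⟩ := Option.ne_none_iff_exists.1 fun hQ =>
      Option.some_ne_none x (hP.trans (hout hQ))
    obtain ⟨τ, hτ, hturn⟩ := h.turning_inner x ⟨(v, w), mem_labelDarts.2 ⟨hvw, hP.symm⟩⟩
    obtain ⟨σ, hσ, hturn'⟩ := h.turning_inner y ⟨(w, v), mem_labelDarts.2 ⟨hvw.symm, hQ.symm⟩⟩
    rw [hP, h.turning_mergeAcross_left hvw hne, ← hP, ← hQ, hturn, hturn']
    split_ifs
    · exact ⟨τ - 1, by lia, by push_cast; ring⟩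
    · exact ⟨τ + σ - 1, by lia, by push_cast; ring⟩
  · obtain ⟨hQ, hx⟩ := ne_and_nonempty_of_mergeAcross hP hx
    rw [h.turning_mergeAcross_of_ne hvw hne hP hQ]
    exact h.turning_inner x hx

theorem RegionLabelling.area_mergeAcross_inner (h : RegionLabelling z H ρ) (hvw : H.Adj v w)
    (hout : ρ (w, v) = none → ρ (v, w) = none) {x : X}
    (hx : (labelDarts (H.deleteEdges {s(v, w)}) (mergeAcross ρ v w) (some x)).Nonempty) :
    0 < doubleArea z (H.deleteEdges {s(v, w)}) (mergeAcross ρ v w) (some x) := by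
  classical
  by_cases hP : some x = ρ (v, w)
  · obtain ⟨y, hQ⟩ := Option.ne_none_iff_exists.1 fun hQ =>
      Option.some_ne_none x (hP.trans (hout hQ))
    have harea := h.area_inner x ⟨(v, w), mem_labelDarts.2 ⟨hvw, hP.symm⟩⟩
    have harea' := h.area_inner y ⟨(w, v), mem_labelDarts.2 ⟨hvw.symm, hQ.symm⟩⟩
    rw [hP, doubleArea_mergeAcross_left hvw, ← hP, ← hQ]
    split_ifs <;> linarith
  · obtain ⟨hQ, hx⟩ := ne_and_nonempty_of_mergeAcross hP hx
    rw [doubleArea_mergeAcross_of_ne hvw hP hQ]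
    exact h.area_inner x hx

theorem RegionLabelling.turning_mergeAcross_outer (h : RegionLabelling z H ρ) (hvw : H.Adj v w)
    (hout : ρ (w, v) = none → ρ (v, w) = none)
    (hne : ∀ u, (nbrs (H.deleteEdges {s(v, w)}) u).Nonempty) :
    turning z (H.deleteEdges {s(v, w)}) (mergeAcross ρ v w) none ≤ 0 := by
  classical
  have houter := h.turning_outer
  by_cases hP : none = ρ (v, w)
  · rw [hP, h.turning_mergeAcross_left hvw hne, ← hP]
    split_ifs with hQ
    · linarith [pi_pos]
    · obtain ⟨y, hy⟩ := Option.ne_none_iff_exists.1 (Ne.symm hQ)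
      have := h.turning_le (x := y) ⟨(w, v), mem_labelDarts.2 ⟨hvw.symm, hy.symm⟩⟩
      rw [← hy]
      linarith
  · rwa [h.turning_mergeAcross_of_ne hvw hne hP fun hQ => hP (hout hQ.symm).symm]

theorem RegionLabelling.deleteEdges (h : RegionLabelling z H ρ) (hvw : H.Adj v w)
    (hne : ∀ u, (nbrs (H.deleteEdges {s(v, w)}) u).Nonempty) :
    ∃ ρ' : V × V → Option X, RegionLabelling z (H.deleteEdges {s(v, w)}) ρ' := by
  wlog hout : ρ (w, v) = none → ρ (v, w) = none generalizing v w
  · rw [Sym2.eq_swap] at hne ⊢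
    exact this hvw.symm hne (by tauto)
  exact ⟨mergeAcross ρ v w, h.mono (H.deleteEdges_le _),
    fun _ hp => h.label_prevDart_deleteEdges hvw
      ((mergeAcross_left ρ v w).trans (mergeAcross_right ρ v w).symm) hp,
    fun _ hx => h.turning_mergeAcross_inner hvw hout hne hx,
    fun _ hx => h.area_mergeAcross_inner hvw hout hx,
    h.turning_mergeAcross_outer hvw hout hne⟩

theorem IsPlaneDrawing.exists_regionLabelling {G : SimpleGraph V} (h : IsPlaneDrawing z G)
    (hne : ∀ v, (nbrs G v).Nonempty) :
    ∃ ρ : V × V → Option (Finset (V × V)), RegionLabelling z G ρ := by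
  obtain ⟨T, hGT, hT⟩ := (Set.toFinite {H | IsPlaneDrawing z H}).exists_le_maximal h
  let labelled : Set (SimpleGraph V) :=
    {H | G ≤ H ∧ ∃ ρ : V × V → Option (Finset (V × V)), RegionLabelling z H ρ}
  obtain ⟨H, ⟨hGH, ρ, hρ⟩, hmin⟩ := (Set.toFinite labelled).exists_minimal
    ⟨T, hGT, triangleLabel z T, regionLabelling_triangleLabel hT⟩
  by_cases hHG : H ≤ G
  · exact hGH.antisymm hHG ▸ ⟨ρ, hρ⟩
  obtain ⟨v, w, hvw, hnot⟩ : ∃ v w, H.Adj v w ∧ ¬ G.Adj v w := by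
    simpa [SimpleGraph.le_iff_adj] using hHG
  have hle : G ≤ H.deleteEdges {s(v, w)} := by
    refine fun a b hab => SimpleGraph.deleteEdges_adj.2 ⟨hGH hab, fun heq => hnot ?_⟩
    rwa [← SimpleGraph.mem_edgeSet, ← Set.mem_singleton_iff.1 heq]
  have hdel := hρ.deleteEdges hvw fun u => (hne u).mono fun a ha => mem_nbrs.2 (hle (mem_nbrs.1 ha))
  have hadj := hmin ⟨hle, hdel⟩ (H.deleteEdges_le _) hvw
  simp at hadj

end Deletion

section Isoperimetric

open Real ComplexConjugate

section Fourier

variable {N : ℕ} [NeZero N]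

theorem sum_conj_dft_mul_dft (f g : ZMod N → ℂ) :
    ∑ k, conj (ZMod.dft f k) * ZMod.dft g k = N * ∑ j, conj (f j) * g j := by
  have hN : (N : ℂ) ≠ 0 := NeZero.ne _
  have hinv (j : ZMod N) : ∑ k, ZMod.stdAddChar (j * k) * ZMod.dft g k = N * g j := by
    have h := ZMod.invDFT_apply (ZMod.dft g) j
    rw [LinearEquiv.symm_apply_apply, smul_eq_mul, eq_inv_mul_iff_mul_eq₀ hN] at h
    simp only [h, smul_eq_mul, mul_comm j]
  calc ∑ k, conj (ZMod.dft f k) * ZMod.dft g k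
      = ∑ k, ∑ j, conj (f j) * (ZMod.stdAddChar (j * k) * ZMod.dft g k) := by
        refine Finset.sum_congr rfl fun k _ => ?_
        rw [ZMod.dft_apply, map_sum, Finset.sum_mul]
        refine Finset.sum_congr rfl fun j _ => ?_
        rw [smul_eq_mul, map_mul, ← AddChar.map_neg_eq_conj, neg_neg]
        ring
    _ = ∑ j, conj (f j) * (N * g j) := by
        rw [Finset.sum_comm]
        simp only [← Finset.mul_sum, hinv]
    _ = N * ∑ j, conj (f j) * g j := by
        rw [Finset.mul_sum]
        exact Finset.sum_congr rfl fun j _ => mul_left_comm _ _ _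

theorem dft_comp_add_one (f : ZMod N → ℂ) (k : ZMod N) :
    ZMod.dft (fun j => f (j + 1)) k = ZMod.stdAddChar k * ZMod.dft f k := by
  rw [ZMod.dft_apply, ZMod.dft_apply, Finset.mul_sum]
  refine Fintype.sum_equiv (Equiv.addRight 1) _ _ fun j => ?_
  rw [Equiv.coe_addRight, smul_eq_mul, smul_eq_mul, ← mul_assoc, ← AddChar.map_add_eq_mul]
  congr 2
  ring

theorem pi_mul_cos_lt_mul_sin {c x : ℝ} (hx : 0 < x) (hxπ : x < π) (hc : π ≤ c * x) :
    π * cos x < c * sin x := by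
  have hsin := sin_pos_of_pos_of_lt_pi hx hxπ
  have hc0 : 0 < c := pos_of_mul_pos_left (pi_pos.trans_le hc) hx.le
  rcases le_or_gt (cos x) 0 with hcos | hcos
  · nlinarith [pi_pos, mul_pos hc0 hsin]
  have hx2 : x < π / 2 := by
    by_contra! hge
    exact hcos.not_ge (cos_nonpos_of_pi_div_two_le_of_le hge (by linarith))
  have htan := lt_tan hx hx2
  rw [tan_eq_sin_div_cos, lt_div_iff₀ hcos] at htan
  nlinarith

theorem two_pi_mul_im_stdAddChar_lt {k : ZMod N} (hk : k ≠ 0) :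
    2 * π * (ZMod.stdAddChar k : ℂ).im < N * ‖(ZMod.stdAddChar k : ℂ) - 1‖ ^ 2 := by
  have hN : (0 : ℝ) < N := Nat.cast_pos.2 (NeZero.pos N)
  have hk_pos : 0 < k.val := Nat.pos_of_ne_zero fun h => hk ((ZMod.val_eq_zero k).1 h)
  obtain ⟨x, hx⟩ : ∃ x, x = π * k.val / N := ⟨_, rfl⟩
  have hexp : (ZMod.stdAddChar k : ℂ) = Complex.exp ((2 * x : ℝ) * Complex.I) := by
    have h := ZMod.stdAddChar_coe (N := N) (k.val : ℤ)
    rw [Int.cast_natCast, ZMod.natCast_zmod_val] at h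
    rw [h, hx]
    push_cast
    ring_nf
  have hx_pos : 0 < x := by rw [hx]; positivity
  have hx_lt : x < π := by
    rw [hx, div_lt_iff₀ hN]
    exact mul_lt_mul_of_pos_left (Nat.cast_lt.2 (ZMod.val_lt k)) pi_pos
  have hNx : π ≤ N * x := by
    rw [hx, mul_div_cancel₀ _ hN.ne']
    exact le_mul_of_one_le_right pi_pos.le (Nat.one_le_cast.2 hk_pos)
  have hnorm : ‖(ZMod.stdAddChar k : ℂ) - 1‖ = 2 * sin x := by
    rw [hexp, mul_comm, Complex.norm_exp_I_mul_ofReal_sub_one, mul_div_cancel_left₀ _ two_ne_zero,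
      norm_of_nonneg (by linarith [sin_pos_of_pos_of_lt_pi hx_pos hx_lt])]
  rw [hnorm, hexp, Complex.exp_ofReal_mul_I_im, sin_two_mul]
  nlinarith [mul_lt_mul_of_pos_left (pi_mul_cos_lt_mul_sin hx_pos hx_lt hNx)
    (sin_pos_of_pos_of_lt_pi hx_pos hx_lt)]

theorem crossProd_eq_im (u w : ℂ) : crossProd u w = (conj u * w).im := by
  simp only [crossProd, Complex.mul_im, Complex.conj_re, Complex.conj_im]
  ring

theorem sum_im_stdAddChar_mul_normSq_dft (ζ : ZMod N → ℂ) :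
    ∑ k, (ZMod.stdAddChar k : ℂ).im * Complex.normSq (ZMod.dft ζ k) =
      N * ∑ j, crossProd (ζ j) (ζ (j + 1)) := by
  have h := congrArg Complex.im (sum_conj_dft_mul_dft ζ fun j => ζ (j + 1))
  rw [← Complex.ofReal_natCast, Complex.im_ofReal_mul, Complex.im_sum, Complex.im_sum] at h
  simp only [crossProd_eq_im, ← h]
  refine Finset.sum_congr rfl fun k _ => ?_
  rw [dft_comp_add_one, mul_left_comm, ← Complex.normSq_eq_conj_mul_self, Complex.im_mul_ofReal]

theorem sum_sq_norm_stdAddChar_sub_one_mul_normSq_dft (ζ : ZMod N → ℂ) :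
    ∑ k, ‖(ZMod.stdAddChar k : ℂ) - 1‖ ^ 2 * Complex.normSq (ZMod.dft ζ k) =
      N * ∑ j, ‖ζ (j + 1) - ζ j‖ ^ 2 := by
  have hdft (k : ZMod N) : ZMod.dft (fun j => ζ (j + 1) - ζ j) k =
      ((ZMod.stdAddChar k : ℂ) - 1) * ZMod.dft ζ k := by
    rw [sub_one_mul, ← dft_comp_add_one]
    exact congrFun (map_sub ZMod.dft (fun j => ζ (j + 1)) ζ) k
  have h := sum_conj_dft_mul_dft (fun j => ζ (j + 1) - ζ j) fun j => ζ (j + 1) - ζ j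
  simp only [← Complex.normSq_eq_conj_mul_self, hdft, Complex.normSq_mul] at h
  simp only [Complex.sq_norm]
  exact_mod_cast h

theorem isoperimetric_polygon (ζ : ZMod N → ℂ) (h : ∀ j, ‖ζ (j + 1) - ζ j‖ = 1) :
    2 * π * ∑ j, crossProd (ζ j) (ζ (j + 1)) < (N : ℝ) ^ 2 := by
  have hN : (0 : ℝ) < N := Nat.cast_pos.2 (NeZero.pos N)
  have hlen := sum_sq_norm_stdAddChar_sub_one_mul_normSq_dft ζ
  simp only [h, one_pow, Finset.sum_const, Finset.card_univ, ZMod.card, nsmul_one] at hlen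
  obtain ⟨k, -, hk⟩ : ∃ k ∈ Finset.univ,
      ‖(ZMod.stdAddChar k : ℂ) - 1‖ ^ 2 * Complex.normSq (ZMod.dft ζ k) ≠ 0 :=
    Finset.exists_ne_zero_of_sum_ne_zero (hlen ▸ (mul_pos hN hN).ne')
  have hk0 : k ≠ 0 := by
    rintro rfl
    simp at hk
  have hsum : ∑ k, 2 * π * (ZMod.stdAddChar k : ℂ).im * Complex.normSq (ZMod.dft ζ k) <
      ∑ k, N * ‖(ZMod.stdAddChar k : ℂ) - 1‖ ^ 2 * Complex.normSq (ZMod.dft ζ k) := by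
    refine Finset.sum_lt_sum (fun j _ => ?_) ⟨k, Finset.mem_univ k, ?_⟩
    · refine mul_le_mul_of_nonneg_right ?_ (Complex.normSq_nonneg _)
      obtain rfl | hj := eq_or_ne j 0
      · simp
      · exact (two_pi_mul_im_stdAddChar_lt hj).le
    · exact mul_lt_mul_of_pos_right (two_pi_mul_im_stdAddChar_lt hk0)
        ((Complex.normSq_nonneg _).lt_of_ne' (right_ne_zero_of_mul hk))
  simp only [mul_assoc, ← Finset.mul_sum, hlen, sum_im_stdAddChar_mul_normSq_dft] at hsum
  refine lt_of_mul_lt_mul_left ?_ hN.le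
  linarith

end Fourier

section Cycles

variable {B : Type*} {f : B → B}

theorem birkhoffSum_mul_of_isPeriodicPt {d : B} {p : ℕ} (hd : Function.IsPeriodicPt f p d)
    (c : B → ℝ) (m : ℕ) : birkhoffSum f c (m * p) d = m * birkhoffSum f c p d := by
  induction m with
  | zero => simp
  | succ m ih =>
    rw [Nat.succ_mul, birkhoffSum_add, ih, (hd.const_mul m).eq, Nat.cast_succ, add_one_mul]

theorem sum_birkhoffSum [Fintype B] (hf : Function.Bijective f) (c : B → ℝ) (M : ℕ) :
    ∑ d, birkhoffSum f c M d = M * ∑ d, c d := by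
  simp only [birkhoffSum]
  rw [Finset.sum_comm, Finset.sum_congr rfl fun i _ => (hf.iterate i).sum_comp c]
  simp

theorem isoperimetric_cycle {d : B} (hd : d ∈ Function.periodicPts f) (ζ : B → ℂ)
    (h : ∀ d, ‖ζ (f d) - ζ d‖ = 1) :
    2 * π * birkhoffSum f (fun d => crossProd (ζ d) (ζ (f d))) (Function.minimalPeriod f d) d <
      (Function.minimalPeriod f d : ℝ) ^ 2 := by
  set p := Function.minimalPeriod f d
  have : NeZero p := ⟨(Function.minimalPeriod_pos_of_mem_periodicPts hd).ne'⟩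
  have hnext (j : ZMod p) : f^[(j + 1).val] d = f (f^[j.val] d) := by
    rw [ZMod.val_add, ZMod.val_one_eq_one_mod, Nat.add_mod_mod,
      Function.iterate_mod_minimalPeriod_eq, Function.iterate_succ_apply']
  convert isoperimetric_polygon (fun j : ZMod p => ζ (f^[j.val] d)) fun j => by
    rw [hnext]; exact h _ using 2
  simp only [hnext, birkhoffSum]
  exact (Finset.sum_nbij' (fun j : ZMod p => j.val) (fun i => (i : ZMod p)) (by simp [ZMod.val_lt])
    (by simp) (by simp) (fun i hi => ZMod.val_cast_of_lt (Finset.mem_range.1 hi)) (by simp)).symm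

theorem isoperimetric_cycles [Fintype B] [Nonempty B] (hf : Function.Injective f) (ζ : B → ℂ)
    (h : ∀ d, ‖ζ (f d) - ζ d‖ = 1) :
    2 * π * ∑ d, crossProd (ζ d) (ζ (f d)) < (Fintype.card B : ℝ) ^ 2 := by
  set c : B → ℝ := fun d => crossProd (ζ d) (ζ (f d))
  set M := (Fintype.card B).factorial with hM
  have hM_pos : (0 : ℝ) < M := Nat.cast_pos.2 (Nat.factorial_pos _)
  have horbit (d : B) : 2 * π * birkhoffSum f c M d < M * Fintype.card B := by
    have hd := hf.mem_periodicPts d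
    have hp := Function.minimalPeriod_pos_of_mem_periodicPts hd
    have hpB := Function.minimalPeriod_le_card (f := f) (x := d)
    obtain ⟨m, hm⟩ := Nat.dvd_factorial hp hpB
    have hMm : (M : ℝ) = m * Function.minimalPeriod f d := by rw [hM, hm, mul_comm, Nat.cast_mul]
    have hm_pos : (0 : ℝ) < m := pos_of_mul_pos_left (hMm ▸ hM_pos) (Nat.cast_nonneg _)
    calc 2 * π * birkhoffSum f c M d
        = m * (2 * π * birkhoffSum f c (Function.minimalPeriod f d) d) := by
          rw [hM, hm, mul_comm (Function.minimalPeriod f d),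
            birkhoffSum_mul_of_isPeriodicPt (Function.isPeriodicPt_minimalPeriod f d)]
          ring
      _ < m * (Function.minimalPeriod f d : ℝ) ^ 2 :=
          mul_lt_mul_of_pos_left (isoperimetric_cycle hd ζ h) hm_pos
      _ = M * Function.minimalPeriod f d := by rw [hMm]; ring
      _ ≤ M * Fintype.card B := by gcongr
  have hsum := Finset.sum_lt_sum_of_nonempty Finset.univ_nonempty fun d (_ : d ∈ Finset.univ) =>
    horbit d
  rw [← Finset.mul_sum, sum_birkhoffSum (Finite.injective_iff_bijective.1 hf), Finset.sum_const,
    Finset.card_univ, nsmul_eq_mul] at hsum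
  refine lt_of_mul_lt_mul_left ?_ hM_pos.le
  linarith

end Cycles

end Isoperimetric

section Orbits

variable {B : Type*} {f : B → B} {d : B}

theorem three_le_minimalPeriod (hd : d ∈ Function.periodicPts f) (h : f (f d) ≠ d) :
    3 ≤ Function.minimalPeriod f d := by
  have hpos := Function.minimalPeriod_pos_of_mem_periodicPts hd
  have hper : f^[Function.minimalPeriod f d] d = d := Function.iterate_minimalPeriod
  by_contra! hlt
  interval_cases Function.minimalPeriod f d
  · exact h ((congrArg f hper).trans hper)
  · exact h hper

theorem exists_iterate_eq_of_card_lt [Fintype B] {k : ℕ} (hcard : Fintype.card B < 2 * k)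
    (h : ∀ d, k ≤ Function.minimalPeriod f d) (d e : B) : ∃ n, f^[n] d = e := by
  classical
  by_contra! hde
  have hinj (c : B) : Set.InjOn (f^[·] c) (Finset.range k) :=
    Function.iterate_injOn_Iio_minimalPeriod.mono fun i hi =>
      (Finset.mem_range.1 hi).trans_le (h c)
  have hdisj : Disjoint ((Finset.range k).image (f^[·] d)) ((Finset.range k).image (f^[·] e)) := by
    simp only [Finset.disjoint_left, Finset.mem_image, Finset.mem_range]
    rintro _ ⟨i, -, rfl⟩ ⟨j, hj, hij⟩
    refine hde (Function.minimalPeriod f e - j + i) ?_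
    rw [Function.iterate_add_apply, ← hij, ← Function.iterate_add_apply,
      Nat.sub_add_cancel (hj.le.trans (h e)), Function.iterate_minimalPeriod]
  have hle := Finset.card_le_univ
    ((Finset.range k).image (f^[·] d) ∪ (Finset.range k).image (f^[·] e))
  rw [Finset.card_union_of_disjoint hdisj, Finset.card_image_of_injOn (hinj d),
    Finset.card_image_of_injOn (hinj e), Finset.card_range] at hle
  lia

theorem sum_eq_birkhoffSum [Fintype B] (hd : d ∈ Function.periodicPts f)
    (h : ∀ e, ∃ n, f^[n] d = e) (F : B → ℝ) :
    ∑ e, F e = birkhoffSum f F (Function.minimalPeriod f d) d := by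
  refine (Finset.sum_nbij (f^[·] d) (fun _ _ => Finset.mem_univ _) (fun i hi j hj hij => ?_)
    (fun e _ => ?_) fun _ _ => rfl).symm
  · exact Function.iterate_injOn_Iio_minimalPeriod (Finset.mem_range.1 hi) (Finset.mem_range.1 hj)
      hij
  · obtain ⟨n, rfl⟩ := h e
    exact ⟨n % Function.minimalPeriod f d, Finset.mem_coe.2 (Finset.mem_range.2
      (Nat.mod_lt n (Function.minimalPeriod_pos_of_mem_periodicPts hd))),
      Function.iterate_mod_minimalPeriod_eq⟩

theorem minimalPeriod_eq_card [Fintype B] (hd : d ∈ Function.periodicPts f)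
    (h : ∀ e, ∃ n, f^[n] d = e) : Function.minimalPeriod f d = Fintype.card B := by
  have hsum := sum_eq_birkhoffSum hd h fun _ => 1
  simp only [birkhoffSum, Finset.sum_const, Finset.card_univ, Finset.card_range,
    nsmul_eq_mul, mul_one] at hsum
  exact_mod_cast hsum.symm

end Orbits

section UnitEdges

open Real

variable {V X : Type*} {z : V → ℂ}

/-- Every edge of the drawing `z` of `H` has length one. -/
def HasUnitEdges (z : V → ℂ) (H : SimpleGraph V) : Prop :=
  ∀ ⦃v a⦄, H.Adj v a → ‖z a - z v‖ = 1

theorem eq_add_sub_of_dist_eq {v a b c : ℂ} {r : ℝ} (hva : dist v a = r) (hvb : dist v b = r)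
    (hca : dist c a = r) (hcb : dist c b = r) (hab : a ≠ b) (hvc : v ≠ c) : c = a + b - v := by
  have hma : dist (a + b - v) a = r := by
    rw [add_sub_assoc, dist_self_add_left, ← dist_eq_norm, dist_comm, hvb]
  have hmb : dist (a + b - v) b = r := by
    rw [add_sub_right_comm, dist_add_self_left, ← dist_eq_norm, dist_comm, hva]
  obtain hv | hc := EuclideanGeometry.eq_of_dist_eq_of_dist_eq_of_finrank_eq_two
    Complex.finrank_real_complex hab hvc hva hca hma hvb hcb hmb
  · have hb : b = v + (v - a) := by linear_combination hv
    rw [dist_eq_norm] at hva hca hcb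
    have hlaw := parallelogram_law_with_norm ℝ (c - v) (v - a)
    rw [sub_add_sub_cancel, ← sub_add_eq_sub_sub, ← hb, hca, hcb, hva] at hlaw
    exact absurd (sub_eq_zero.1 (norm_eq_zero.1 (mul_self_eq_zero.1 (by linarith)))).symm hvc
  · exact hc.symm

theorem ccwGap_dirArg_of_eq_add_sub (hz : Function.Injective z) {v a b c : V} (hva : v ≠ a)
    (hvb : v ≠ b) (hc : z c = z a + z b - z v) :
    ccwGap (dirArg z c b) (dirArg z c a) = ccwGap (dirArg z v a) (dirArg z v b) := by
  have hcb : dirArg z c b = dirArg z a v := by rw [dirArg, dirArg, hc]; ring_nf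
  have hca : dirArg z c a = dirArg z b v := by rw [dirArg, dirArg, hc]; ring_nf
  rw [hcb, hca, dirArg_eq_dirArg_add_pi hz hva.symm, dirArg_eq_dirArg_add_pi hz hvb.symm,
    ccwGap, ccwGap, add_sub_add_right_eq_sub]

variable [Fintype V] {H : SimpleGraph V} {ρ : V × V → Option X} {L : Option X}

theorem sum_corner_labelDarts (z : V → ℂ) (H : SimpleGraph V) (ρ : V × V → Option X)
    (L : Option X) : ∑ p ∈ labelDarts H ρ L, corner z H p.1 p.2 =
      (labelDarts H ρ L).card * π - turning z H ρ L := by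
  rw [turning, Finset.sum_sub_distrib, Finset.sum_const, nsmul_eq_mul, sub_sub_cancel]

theorem corner_lt_of_turning_eq_two_pi (hturn : turning z H ρ L = 2 * π)
    (hcard : 2 ≤ (labelDarts H ρ L).card) {p : V × V} (hp : p ∈ labelDarts H ρ L) :
    corner z H p.1 p.2 < ((labelDarts H ρ L).card - 2) * π := by
  have hlt : corner z H p.1 p.2 < ∑ p ∈ labelDarts H ρ L, corner z H p.1 p.2 := by
    obtain ⟨q, hq, hqp⟩ := Finset.exists_mem_ne hcard p
    exact Finset.single_lt_sum hqp hp hq (corner_pos z H _ _) fun r _ _ => (corner_pos z H _ _).le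
  rw [sum_corner_labelDarts, hturn] at hlt
  linarith

theorem nextNbr_ne {v a : V} (h : corner z H v a < 2 * π) : nextNbr z H v a ≠ a := fun hnext => by
  rw [corner_eq, hnext, ccwGap_self] at h
  exact h.false

/-- The map `prevDart` as a permutation of the boundary of the region `L`. -/
noncomputable def RegionLabelling.boundaryMap (h : RegionLabelling z H ρ) (L : Option X)
    (p : labelDarts H ρ L) : labelDarts H ρ L :=
  ⟨prevDart z H p, by
    have hp := mem_labelDarts.1 p.2
    exact mem_labelDarts.2 ⟨prevDart_adj hp.1, (h.label_prevDart p hp.1).trans hp.2⟩⟩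

theorem RegionLabelling.boundaryMap_injective (h : RegionLabelling z H ρ) (L : Option X) :
    Function.Injective (h.boundaryMap L) := fun p q hpq =>
  Subtype.ext <| h.prevDart_injOn (mem_labelDarts.1 p.2).1 (mem_labelDarts.1 q.2).1 <|
    congrArg Subtype.val hpq

theorem RegionLabelling.iterate_boundaryMap (h : RegionLabelling z H ρ) (p : labelDarts H ρ L)
    (n : ℕ) : ((h.boundaryMap L)^[n] p : V × V) = (prevDart z H)^[n] p := by
  induction n with
  | zero => rfl
  | succ n ih => rw [Function.iterate_succ_apply', Function.iterate_succ_apply', ← ih]; rfl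

/-- Two orbits of `prevDart` would each have at least three darts. -/
theorem RegionLabelling.boundary_eq_cycle (h : RegionLabelling z H ρ)
    (hturn : turning z H ρ L = 2 * π) (hcard₂ : 2 ≤ (labelDarts H ρ L).card)
    (hcard₄ : (labelDarts H ρ L).card ≤ 4) {p : V × V} (hp : p ∈ labelDarts H ρ L) :
    (prevDart z H)^[(labelDarts H ρ L).card] p = p ∧
      ∀ F : V × V → ℝ, ∑ q ∈ labelDarts H ρ L, F q =
        ∑ i ∈ Finset.range (labelDarts H ρ L).card, F ((prevDart z H)^[i] p) := by
  have hper (q) : q ∈ Function.periodicPts (h.boundaryMap L) :=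
    (h.boundaryMap_injective L).mem_periodicPts q
  have hcard : Fintype.card (labelDarts H ρ L) = (labelDarts H ρ L).card := Fintype.card_coe _
  have hthree (q) : 3 ≤ Function.minimalPeriod (h.boundaryMap L) q := by
    refine three_le_minimalPeriod (hper q) fun hq => ?_
    have hcorner := corner_lt_of_turning_eq_two_pi hturn hcard₂ q.2
    refine nextNbr_ne (hcorner.trans_le ?_) (congrArg Prod.snd (congrArg Subtype.val hq))
    have : ((labelDarts H ρ L).card : ℝ) ≤ 4 := by exact_mod_cast hcard₄
    nlinarith [pi_pos]
  have hcycle := exists_iterate_eq_of_card_lt (by lia) hthree ⟨p, hp⟩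
  have hmin := (minimalPeriod_eq_card (hper _) hcycle).trans hcard
  constructor
  · rw [← h.iterate_boundaryMap ⟨p, hp⟩, ← hmin, Function.iterate_minimalPeriod]
  · intro F
    rw [← Finset.sum_coe_sort, sum_eq_birkhoffSum (hper _) hcycle fun q => F q, hmin, birkhoffSum]
    simp only [h.iterate_boundaryMap]

/-- The region `L` is a triangle: a boundary of three darts which turns exactly once. -/
def IsTriangle (z : V → ℂ) (H : SimpleGraph V) (ρ : V × V → Option X) (L : Option X) : Prop :=
  (labelDarts H ρ L).card = 3 ∧ turning z H ρ L = 2 * π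

theorem RegionLabelling.corner_eq_pi_div_three (h : RegionLabelling z H ρ)
    (hunit : HasUnitEdges z H) (hL : IsTriangle z H ρ L) {p : V × V} (hp : p ∈ labelDarts H ρ L) :
    corner z H p.1 p.2 = π / 3 := by
  obtain ⟨hcard, hturn⟩ := hL
  obtain ⟨v, a⟩ := p
  have hlt := corner_lt_of_turning_eq_two_pi hturn (by lia) hp
  have hcycle := (h.boundary_eq_cycle hturn (by lia) (by lia) hp).1
  rw [hcard] at hlt hcycle
  push_cast at hlt
  have hva : H.Adj v a := (mem_labelDarts.1 hp).1
  have hvb : H.Adj v (nextNbr z H v a) := nextNbr_adj hva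
  have hba : H.Adj (nextNbr z H v a) a := by
    have hnext : nextNbr z H (nextNbr z H v a) v = a := congrArg Prod.snd hcycle
    simpa only [hnext] using nextNbr_adj (z := z) hvb.symm
  have hinner := inner_eq_norm_mul_cos (z a - z v) (z (nextNbr z H v a) - z v)
  have hlaw := norm_sub_sq_real (z a - z v) (z (nextNbr z H v a) - z v)
  rw [sub_sub_sub_cancel_right, hunit hba, hunit hva, hunit hvb] at hlaw
  rw [hunit hva, hunit hvb, one_mul, one_mul] at hinner
  refine injOn_cos ⟨(corner_pos z H v a).le, by linarith⟩ ⟨by positivity, by linarith [pi_pos]⟩ ?_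
  rw [cos_pi_div_three, corner_eq, dirArg, dirArg, ← hinner]
  linarith

theorem RegionLabelling.doubleArea_of_isTriangle (h : RegionLabelling z H ρ)
    (hunit : HasUnitEdges z H) (hL : IsTriangle z H ρ L) : doubleArea z H ρ L = √3 / 2 := by
  have ⟨hcard, hturn⟩ := hL
  obtain ⟨⟨v, a⟩, hp⟩ := Finset.card_pos.1 (Nat.lt_of_lt_of_eq three_pos hcard.symm)
  have hcorner := h.corner_eq_pi_div_three hunit hL hp
  obtain ⟨hcycle, hsum⟩ := h.boundary_eq_cycle hturn (by lia) (by lia) hp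
  rw [hcard] at hcycle hsum
  have hva : H.Adj v a := (mem_labelDarts.1 hp).1
  have hnext : nextNbr z H (nextNbr z H v a) v = a := congrArg Prod.snd hcycle
  have hcross := crossProd_eq_norm_mul_sin (z a - z v) (z (nextNbr z H v a) - z v)
  rw [corner_eq, dirArg, dirArg] at hcorner
  rw [hunit hva, hunit (nextNbr_adj hva), hcorner, sin_pi_div_three, one_mul, one_mul] at hcross
  rw [doubleArea, hsum, ← hcross]
  simp only [Finset.sum_range_succ, Finset.sum_range_zero, Function.iterate_succ_apply,
    Function.iterate_zero_apply, prevDart, hnext, crossProd, Complex.sub_re, Complex.sub_im]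
  ring

theorem RegionLabelling.corner_prevDart_prevDart (h : RegionLabelling z H ρ)
    (hunit : HasUnitEdges z H) (hcard : (labelDarts H ρ L).card = 4)
    (hturn : turning z H ρ L = 2 * π) {p : V × V} (hp : p ∈ labelDarts H ρ L) :
    corner z H (prevDart z H (prevDart z H p)).1 (prevDart z H (prevDart z H p)).2 =
      corner z H p.1 p.2 := by
  have hnext_ne {v a} (hva : (v, a) ∈ labelDarts H ρ L) : nextNbr z H v a ≠ a := by
    have hlt := corner_lt_of_turning_eq_two_pi hturn (by lia) hva
    rw [hcard] at hlt
    push_cast at hlt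
    exact nextNbr_ne (by linarith)
  have hcycle := (h.boundary_eq_cycle hturn (by lia) (by lia) hp).1
  rw [hcard] at hcycle
  obtain ⟨v, a⟩ := p
  have hva : H.Adj v a := (mem_labelDarts.1 hp).1
  have hab := hnext_ne hp
  have hvc := hnext_ne (h.boundaryMap L ⟨_, hp⟩).2
  have hvb : H.Adj v (nextNbr z H v a) := nextNbr_adj hva
  have hbc := nextNbr_adj (z := z) hvb.symm
  have hca := nextNbr_adj (z := z) hbc.symm
  have hnext : nextNbr z H (nextNbr z H (nextNbr z H v a) v) (nextNbr z H v a) = a :=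
    congrArg Prod.snd hcycle
  change nextNbr z H (nextNbr z H v a) v ≠ v at hvc
  change corner z H (nextNbr z H (nextNbr z H v a) v) (nextNbr z H v a) = corner z H v a
  rw [corner_eq, corner_eq, hnext]
  rw [hnext] at hca
  have hdist {x y} (hxy : H.Adj x y) : dist (z x) (z y) = 1 := by
    rw [dist_comm, dist_eq_norm, hunit hxy]
  exact ccwGap_dirArg_of_eq_add_sub h.injective hva.ne hvb.ne <|
    eq_add_sub_of_dist_eq (hdist hva) (hdist hvb) (hdist hca) (hdist hbc.symm)
      (h.injective.ne hab.symm) (h.injective.ne hvc.symm)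

end UnitEdges

section Charge

open Real

/-- The charge of a corner of angle `θ`, scaled so that the corners at a vertex of degree `d`
carry the total charge `6 - d` and those of a unit triangle carry none. -/
noncomputable def cornerCharge (θ : ℝ) : ℝ := 3 * θ / π - 1

/-- The part of the charge of its region that a corner of angle `θ` passes on to its vertex: the
charge of the corner, truncated to `[0, 1]`. -/
noncomputable def cornerShare (θ : ℝ) : ℝ := max 0 (min 1 (cornerCharge θ))

variable {θ : ℝ}

theorem cornerCharge_pi_div_three : cornerCharge (π / 3) = 0 := by
  rw [cornerCharge, mul_div_cancel₀ _ three_ne_zero, div_self pi_ne_zero, sub_self]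

theorem cornerCharge_add_cornerCharge_pi_sub (θ : ℝ) :
    cornerCharge θ + cornerCharge (π - θ) = 1 := by
  simp only [cornerCharge]
  field

theorem cornerShare_nonneg (θ : ℝ) : 0 ≤ cornerShare θ := le_max_left _ _

theorem cornerShare_le_one (θ : ℝ) : cornerShare θ ≤ 1 := max_le zero_le_one (min_le_left _ _)

theorem cornerShare_eq_zero (h : cornerCharge θ ≤ 0) : cornerShare θ = 0 :=
  max_eq_left ((min_le_right _ _).trans h)

theorem cornerShare_eq_one (h : 1 ≤ cornerCharge θ) : cornerShare θ = 1 := by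
  rw [cornerShare, min_eq_left h, max_eq_right zero_le_one]

theorem cornerShare_le_cornerCharge (h : 0 ≤ cornerCharge θ) : cornerShare θ ≤ cornerCharge θ :=
  max_le h (min_le_right _ _)

theorem cornerCharge_le_cornerShare (h : cornerCharge θ ≤ 1) : cornerCharge θ ≤ cornerShare θ :=
  le_max_of_le_right (le_min h le_rfl)

theorem cornerShare_add_cornerShare_pi_sub_le (θ : ℝ) :
    cornerShare θ + cornerShare (π - θ) ≤ 1 := by
  rcases le_total (cornerCharge θ) 0 with h | h
  · rw [cornerShare_eq_zero h, zero_add]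
    exact cornerShare_le_one _
  rcases le_total (cornerCharge (π - θ)) 0 with h' | h'
  · rw [cornerShare_eq_zero h', add_zero]
    exact cornerShare_le_one _
  · rw [← cornerCharge_add_cornerCharge_pi_sub θ]
    exact add_le_add (cornerShare_le_cornerCharge h) (cornerShare_le_cornerCharge h')

section Sums

variable {ι : Type*} (S : Finset ι) (f : ι → ℝ)

theorem sum_cornerCharge :
    ∑ i ∈ S, cornerCharge (f i) = 3 * (∑ i ∈ S, f i) / π - S.card := by
  simp only [cornerCharge, Finset.sum_sub_distrib, ← Finset.sum_div, ← Finset.mul_sum,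
    Finset.sum_const, nsmul_eq_mul, mul_one]

theorem sum_cornerShare_le_card : ∑ i ∈ S, cornerShare (f i) ≤ S.card := by
  simpa using Finset.sum_le_card_nsmul S _ 1 fun i _ => cornerShare_le_one (f i)

theorem sum_cornerShare_le_sum_cornerCharge_or :
    ∑ i ∈ S, cornerShare (f i) ≤ ∑ i ∈ S, cornerCharge (f i) ∨
      ∑ i ∈ S, cornerShare (f i) ≤ S.card - 1 := by
  classical
  by_cases! h : ∃ i ∈ S, cornerCharge (f i) ≤ 0
  · obtain ⟨i, hi, hle⟩ := h
    right
    rw [← Finset.add_sum_erase _ _ hi, cornerShare_eq_zero hle, zero_add,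
      ← Finset.cast_card_erase_of_mem hi]
    exact sum_cornerShare_le_card _ f
  · exact .inl (Finset.sum_le_sum fun i hi => cornerShare_le_cornerCharge (h i hi).le)

end Sums

variable {V X : Type*} [Fintype V] {z : V → ℂ} {H : SimpleGraph V} {ρ : V × V → Option X}
  {L : Option X}

/-- The total charge of the corners of the region `L`. -/
noncomputable def regionCharge (z : V → ℂ) (H : SimpleGraph V) (ρ : V × V → Option X)
    (L : Option X) : ℝ :=
  ∑ p ∈ labelDarts H ρ L, cornerCharge (corner z H p.1 p.2)

theorem regionCharge_eq (z : V → ℂ) (H : SimpleGraph V) (ρ : V × V → Option X) (L : Option X) :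
    regionCharge z H ρ L = 2 * (labelDarts H ρ L).card - 3 / π * turning z H ρ L := by
  rw [regionCharge, sum_cornerCharge, sum_corner_labelDarts]
  field

theorem two_mul_card_le_regionCharge (h : turning z H ρ L ≤ 0) :
    2 * ((labelDarts H ρ L).card : ℝ) ≤ regionCharge z H ρ L := by
  rw [regionCharge_eq, le_sub_self_iff]
  exact mul_nonpos_of_nonneg_of_nonpos (by positivity) h

theorem regionCharge_of_turning_eq_two_pi (h : turning z H ρ L = 2 * π) :
    regionCharge z H ρ L = 2 * (labelDarts H ρ L).card - 6 := by
  rw [regionCharge_eq, h]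
  field

theorem RegionLabelling.turning_nonpos_or_eq_two_pi (h : RegionLabelling z H ρ) (x : X) :
    turning z H ρ (some x) ≤ 0 ∨
      turning z H ρ (some x) = 2 * π ∧ 3 ≤ (labelDarts H ρ (some x)).card := by
  rcases (labelDarts H ρ (some x)).eq_empty_or_nonempty with hempty | hx
  · simp [turning, hempty]
  obtain ⟨τ, hτ_le, hτ⟩ := h.turning_inner x hx
  rcases hτ_le.lt_or_eq with hlt | rfl
  · left
    rw [hτ]
    exact mul_nonpos_of_nonneg_of_nonpos two_pi_pos.le (by exact_mod_cast Int.lt_add_one_iff.1 hlt)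
  · rw [Int.cast_one, mul_one] at hτ
    have hpos := Finset.sum_pos (fun p _ => corner_pos z H p.1 p.2) hx
    rw [sum_corner_labelDarts, hτ, ← sub_mul, mul_pos_iff_of_pos_right pi_pos, sub_pos] at hpos
    exact .inr ⟨hτ, by exact_mod_cast hpos⟩

theorem RegionLabelling.doubleArea_nonneg (h : RegionLabelling z H ρ) (x : X) :
    0 ≤ doubleArea z H ρ (some x) := by
  rcases (labelDarts H ρ (some x)).eq_empty_or_nonempty with hempty | hx
  · rw [doubleArea, hempty, Finset.sum_empty]
  · exact (h.area_inner x hx).le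

theorem RegionLabelling.sum_cornerShare_of_isTriangle (h : RegionLabelling z H ρ)
    (hunit : HasUnitEdges z H) (hL : IsTriangle z H ρ L) :
    ∑ p ∈ labelDarts H ρ L, cornerShare (corner z H p.1 p.2) = 0 :=
  Finset.sum_eq_zero fun p hp => by
    rw [h.corner_eq_pi_div_three hunit hL hp, cornerShare_eq_zero cornerCharge_pi_div_three.le]

/-- A unit quadrilateral is a rhombus: its angles are `θ`, `π - θ`, `θ`, `π - θ`. -/
theorem RegionLabelling.sum_cornerShare_le_two (h : RegionLabelling z H ρ)
    (hunit : HasUnitEdges z H) (hcard : (labelDarts H ρ L).card = 4)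
    (hturn : turning z H ρ L = 2 * π) :
    ∑ p ∈ labelDarts H ρ L, cornerShare (corner z H p.1 p.2) ≤ 2 := by
  obtain ⟨p, hp⟩ := Finset.card_pos.1 (Nat.lt_of_lt_of_eq four_pos hcard.symm)
  have hsum := (h.boundary_eq_cycle hturn (by lia) (by lia) hp).2
  have hangle := sum_corner_labelDarts z H ρ L
  have hopp := h.corner_prevDart_prevDart hunit hcard hturn hp
  have hopp' := h.corner_prevDart_prevDart hunit hcard hturn (h.boundaryMap L ⟨p, hp⟩).2
  change corner z H (prevDart z H (prevDart z H (prevDart z H p))).1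
    (prevDart z H (prevDart z H (prevDart z H p))).2 =
    corner z H (prevDart z H p).1 (prevDart z H p).2 at hopp'
  rw [hsum, hcard, hturn] at hangle
  rw [hsum, hcard]
  simp only [Finset.sum_range_succ, Finset.sum_range_zero, Function.iterate_succ_apply,
    Function.iterate_zero_apply, zero_add, hopp, hopp', Nat.cast_ofNat] at hangle ⊢
  have hadj : corner z H (prevDart z H p).1 (prevDart z H p).2 = π - corner z H p.1 p.2 := by
    linarith
  have hle := cornerShare_add_cornerShare_pi_sub_le (corner z H p.1 p.2)
  rw [hadj]
  linarith

theorem RegionLabelling.sum_cornerShare_le (h : RegionLabelling z H ρ)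
    (hunit : HasUnitEdges z H) (x : X) :
    ∑ p ∈ labelDarts H ρ (some x), cornerShare (corner z H p.1 p.2) ≤
      regionCharge z H ρ (some x) := by
  have hle := sum_cornerShare_le_card (labelDarts H ρ (some x)) fun p => corner z H p.1 p.2
  rcases h.turning_nonpos_or_eq_two_pi x with hturn | ⟨hturn, hcard⟩
  · linarith [two_mul_card_le_regionCharge hturn, Nat.cast_nonneg (α := ℝ)
      (labelDarts H ρ (some x)).card]
  have hcharge := regionCharge_of_turning_eq_two_pi hturn
  obtain h₃ | h₄ | h₅ | h₆ : (labelDarts H ρ (some x)).card = 3 ∨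
      (labelDarts H ρ (some x)).card = 4 ∨ (labelDarts H ρ (some x)).card = 5 ∨
      6 ≤ (labelDarts H ρ (some x)).card := by lia
  · rw [h.sum_cornerShare_of_isTriangle hunit ⟨h₃, hturn⟩, hcharge, h₃]
    norm_num
  · have hrhombus := h.sum_cornerShare_le_two hunit h₄ hturn
    rw [h₄] at hcharge
    push_cast at hcharge
    linarith
  · rcases sum_cornerShare_le_sum_cornerCharge_or (labelDarts H ρ (some x))
      fun p => corner z H p.1 p.2 with hshare | hshare
    · exact hshare
    · rw [h₅] at hcharge hshare
      push_cast at hcharge hshare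
      linarith
  · have : (6 : ℝ) ≤ (labelDarts H ρ (some x)).card := by exact_mod_cast h₆
    linarith

open Classical in
theorem RegionLabelling.card_le_regionCharge (h : RegionLabelling z H ρ) (x : X) :
    ((labelDarts H ρ (some x)).card : ℝ) ≤ 2 * regionCharge z H ρ (some x) +
      if IsTriangle z H ρ (some x) then 3 else 0 := by
  rcases h.turning_nonpos_or_eq_two_pi x with hturn | ⟨hturn, hcard⟩
  · have hbonus : (0 : ℝ) ≤ if IsTriangle z H ρ (some x) then 3 else 0 := by
      split_ifs <;> norm_num
    linarith [two_mul_card_le_regionCharge hturn, Nat.cast_nonneg (α := ℝ)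
      (labelDarts H ρ (some x)).card]
  · rw [regionCharge_of_turning_eq_two_pi hturn]
    split_ifs with htri
    · rw [htri.1]
      norm_num
    · have : (labelDarts H ρ (some x)).card ≠ 3 := fun h₃ => htri ⟨h₃, hturn⟩
      have : (4 : ℝ) ≤ (labelDarts H ρ (some x)).card := by
        exact_mod_cast hcard.lt_of_ne' this
      linarith

open Classical in
theorem RegionLabelling.ite_isTriangle_le_doubleArea (h : RegionLabelling z H ρ)
    (hunit : HasUnitEdges z H) (x : X) :
    (if IsTriangle z H ρ (some x) then √3 / 2 else 0) ≤ doubleArea z H ρ (some x) := by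
  split_ifs with htri
  · exact (h.doubleArea_of_isTriangle hunit htri).ge
  · exact h.doubleArea_nonneg x

theorem RegionLabelling.two_pi_mul_neg_doubleArea_lt (h : RegionLabelling z H ρ)
    (hunit : HasUnitEdges z H) (hne : (labelDarts H ρ L).Nonempty) :
    2 * π * -doubleArea z H ρ L < ((labelDarts H ρ L).card : ℝ) ^ 2 := by
  have := hne.to_subtype
  have hinj := h.boundaryMap_injective L
  have hiso := isoperimetric_cycles hinj (fun p => z p.1.1) fun p =>
    hunit (nextNbr_adj (mem_labelDarts.1 p.2).1)
  have harea : ∑ p, crossProd (z p.1.1) (z (h.boundaryMap L p).1.1) = -doubleArea z H ρ L :=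
    calc ∑ p, crossProd (z p.1.1) (z (h.boundaryMap L p).1.1)
        = ∑ p, -crossProd (z (h.boundaryMap L p).1.1) (z (h.boundaryMap L p).1.2) :=
          Finset.sum_congr rfl fun p _ => (neg_crossProd (z _) (z _)).symm
      _ = ∑ p : labelDarts H ρ L, -crossProd (z p.1.1) (z p.1.2) :=
          (Finite.injective_iff_bijective.1 hinj).sum_comp fun p : labelDarts H ρ L =>
            -crossProd (z p.1.1) (z p.1.2)
      _ = -doubleArea z H ρ L := by
          rw [Finset.sum_neg_distrib, doubleArea,
            ← Finset.sum_coe_sort (labelDarts H ρ L) fun p => crossProd (z p.1) (z p.2)]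
  rwa [harea, Fintype.card_coe] at hiso

end Charge

section Counting

open Real

variable {V X : Type*} [Fintype V] {z : V → ℂ} {H : SimpleGraph V} {ρ : V × V → Option X}

/-- The total deficit `4n₁ + 3n₂ + 2n₃ + n₄` of a graph without isolated vertices. The
subtraction is truncated, so vertices of degree at least five do not count. -/
noncomputable def degreeDeficit (H : SimpleGraph V) : ℕ := ∑ v, (5 - (nbrs H v).card)

theorem sum_cornerCharge_nbrs (h : IsPlaneDrawing z H) {v : V} (hv : (nbrs H v).Nonempty) :
    ∑ a ∈ nbrs H v, cornerCharge (corner z H v a) = 6 - (nbrs H v).card := by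
  have hsum : ∑ a ∈ nbrs H v, corner z H v a = 2 * π := sum_cornerAngle (h.dirArg_injOn_nbrs v) hv
  rw [sum_cornerCharge, hsum]
  field

theorem le_sum_cornerShare_nbrs (h : IsPlaneDrawing z H) {v : V} (hv : (nbrs H v).Nonempty) :
    6 - ((nbrs H v).card : ℝ) - (5 - (nbrs H v).card : ℕ) ≤
      ∑ a ∈ nbrs H v, cornerShare (corner z H v a) := by
  have hnonneg (a : V) (_ : a ∈ nbrs H v) := cornerShare_nonneg (corner z H v a)
  rcases lt_or_ge 5 (nbrs H v).card with h₆ | h₅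
  · have : (6 : ℝ) ≤ (nbrs H v).card := by exact_mod_cast h₆
    refine le_trans ?_ (Finset.sum_nonneg hnonneg)
    rw [Nat.sub_eq_zero_of_le h₆.le, Nat.cast_zero, sub_zero]
    linarith
  rw [Nat.cast_sub h₅]
  by_cases! hlarge : ∃ a ∈ nbrs H v, 1 ≤ cornerCharge (corner z H v a)
  · obtain ⟨a, ha, hle⟩ := hlarge
    calc 6 - ((nbrs H v).card : ℝ) - ((5 : ℕ) - (nbrs H v).card) = 1 := by push_cast; ring
      _ = cornerShare (corner z H v a) := (cornerShare_eq_one hle).symm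
      _ ≤ _ := Finset.single_le_sum hnonneg ha
  · have : ((nbrs H v).card : ℝ) ≤ 5 := by exact_mod_cast h₅
    calc 6 - ((nbrs H v).card : ℝ) - ((5 : ℕ) - (nbrs H v).card) ≤ 6 - (nbrs H v).card := by
          push_cast; linarith
      _ = _ := (sum_cornerCharge_nbrs h hv).symm
      _ ≤ _ := Finset.sum_le_sum fun a ha => cornerCharge_le_cornerShare (hlarge a ha).le

theorem six_le_degreeDeficit [Nonempty V] (hne : ∀ v, (nbrs H v).Nonempty)
    (hcard : Fintype.card V ≤ 3) : 6 ≤ degreeDeficit H := by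
  have hlt (v : V) : (nbrs H v).card < Fintype.card V :=
    Finset.card_lt_univ_of_notMem fun h => H.loopless.irrefl v (mem_nbrs.1 h)
  have htwo : 2 ≤ Fintype.card V := by
    obtain ⟨v⟩ := ‹Nonempty V›
    exact Nat.lt_of_le_of_lt (Finset.card_pos.2 (hne v)) (hlt v)
  calc 6 ≤ Fintype.card V * 3 := by lia
    _ = ∑ _v : V, 3 := by rw [Finset.sum_const, Finset.card_univ, smul_eq_mul]
    _ ≤ degreeDeficit H := Finset.sum_le_sum fun v _ => by have := hlt v; lia

theorem sum_sum_labelDarts [Fintype X] (H : SimpleGraph V) (ρ : V × V → Option X) (F : V × V → ℝ) :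
    ∑ L, ∑ p ∈ labelDarts H ρ L, F p = ∑ v, ∑ a ∈ nbrs H v, F (v, a) := by
  classical
  simp only [sum_labelDarts]
  rw [Finset.sum_comm]
  simp only [Finset.sum_fiberwise]

theorem sum_regionCharge [Fintype X] (h : IsPlaneDrawing z H) (hne : ∀ v, (nbrs H v).Nonempty)
    (ρ : V × V → Option X) :
    ∑ L, regionCharge z H ρ L = ∑ v, (6 - ((nbrs H v).card : ℝ)) := by
  simp only [regionCharge]
  rw [sum_sum_labelDarts H ρ fun p => cornerCharge (corner z H p.1 p.2)]
  exact Finset.sum_congr rfl fun v _ => sum_cornerCharge_nbrs h (hne v)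

theorem sum_doubleArea [Fintype X] (z : V → ℂ) (H : SimpleGraph V) (ρ : V × V → Option X) :
    ∑ L, doubleArea z H ρ L = 0 := by
  simp only [doubleArea]
  rw [sum_sum_labelDarts H ρ fun p => crossProd (z p.1) (z p.2), ← self_eq_neg,
    ← Finset.sum_neg_distrib]
  calc ∑ v, ∑ a ∈ nbrs H v, crossProd (z v) (z a)
      = ∑ a, ∑ v ∈ nbrs H a, crossProd (z v) (z a) :=
        Finset.sum_comm' fun v a => by simp [H.adj_comm]
    _ = ∑ v, -∑ a ∈ nbrs H v, crossProd (z v) (z a) := by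
        simp only [← Finset.sum_neg_distrib, neg_crossProd]

theorem sum_card_labelDarts [Fintype X] (H : SimpleGraph V) (ρ : V × V → Option X) :
    ∑ L, ((labelDarts H ρ L).card : ℝ) = ∑ v, ((nbrs H v).card : ℝ) := by
  simpa using sum_sum_labelDarts H ρ fun _ => 1

open Classical in
/-- The number of triangular regions. -/
noncomputable def numTriangles [Fintype X] (z : V → ℂ) (H : SimpleGraph V)
    (ρ : V × V → Option X) : ℕ :=
  Finset.card {x | IsTriangle z H ρ (some x)}

theorem RegionLabelling.card_outer_le_degreeDeficit [Finite X] (h : RegionLabelling z H ρ)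
    (hunit : HasUnitEdges z H) (hne : ∀ v, (nbrs H v).Nonempty) :
    (labelDarts H ρ none).card ≤ degreeDeficit H := by
  have := Fintype.ofFinite X
  have hvertex := Finset.sum_le_sum fun v (_ : v ∈ Finset.univ) =>
    le_sum_cornerShare_nbrs h.toIsPlaneDrawing (hne v)
  rw [← sum_sum_labelDarts H ρ fun p => cornerShare (corner z H p.1 p.2), Fintype.sum_option,
    Finset.sum_sub_distrib, ← sum_regionCharge h.toIsPlaneDrawing hne ρ, Fintype.sum_option,
    ← Nat.cast_sum, ← degreeDeficit] at hvertex
  have hinner := Finset.sum_le_sum fun x (_ : x ∈ Finset.univ) => h.sum_cornerShare_le hunit x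
  have houter := sum_cornerShare_le_card (labelDarts H ρ none) fun p => corner z H p.1 p.2
  have hcharge := two_mul_card_le_regionCharge h.turning_outer
  exact_mod_cast show ((labelDarts H ρ none).card : ℝ) ≤ degreeDeficit H by linarith

theorem RegionLabelling.card_add_card_outer_le [Fintype X] (h : RegionLabelling z H ρ)
    (hne : ∀ v, (nbrs H v).Nonempty) :
    Fintype.card V + (labelDarts H ρ none).card ≤ numTriangles z H ρ + degreeDeficit H := by
  classical
  have hinner := Finset.sum_le_sum fun x (_ : x ∈ Finset.univ) => h.card_le_regionCharge x
  rw [Finset.sum_add_distrib, ← Finset.mul_sum, ← Finset.sum_filter, Finset.sum_const,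
    nsmul_eq_mul] at hinner
  have hdarts := sum_card_labelDarts H ρ
  have hcharge := sum_regionCharge h.toIsPlaneDrawing hne ρ
  rw [Fintype.sum_option] at hdarts hcharge
  have houter := two_mul_card_le_regionCharge h.turning_outer
  have hdeficit : Fintype.card V * 5 ≤ ∑ v, (nbrs H v).card + degreeDeficit H := by
    rw [degreeDeficit, ← Finset.sum_add_distrib, ← smul_eq_mul, ← Finset.card_univ]
    exact Finset.card_nsmul_le_sum _ _ _ fun v _ => le_add_tsub
  replace hdeficit : (Fintype.card V * 5 : ℝ) ≤ ∑ v, ((nbrs H v).card : ℝ) + degreeDeficit H := by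
    exact_mod_cast hdeficit
  simp only [Finset.sum_sub_distrib, Finset.sum_const, Finset.card_univ, nsmul_eq_mul] at hcharge
  have hle : (Fintype.card V : ℝ) + (labelDarts H ρ none).card ≤
      numTriangles z H ρ + degreeDeficit H := by
    rw [numTriangles]
    linarith
  exact_mod_cast hle

theorem RegionLabelling.numTriangles_mul_le [Fintype X] (h : RegionLabelling z H ρ)
    (hunit : HasUnitEdges z H) : numTriangles z H ρ * (√3 / 2) ≤ -doubleArea z H ρ none := by
  classical
  have hinner := Finset.sum_le_sum fun x (_ : x ∈ Finset.univ) =>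
    h.ite_isTriangle_le_doubleArea hunit x
  rw [← Finset.sum_filter, Finset.sum_const, nsmul_eq_mul] at hinner
  have hsum := sum_doubleArea z H ρ
  rw [Fintype.sum_option] at hsum
  rw [numTriangles]
  linarith

/-- Without outer darts, the positive areas of the inner regions could not sum to zero. -/
theorem RegionLabelling.outer_nonempty [Nonempty V] [Finite X] (h : RegionLabelling z H ρ)
    (hne : ∀ v, (nbrs H v).Nonempty) : (labelDarts H ρ none).Nonempty := by
  have := Fintype.ofFinite X
  by_contra! hempty
  obtain ⟨v⟩ := ‹Nonempty V›
  obtain ⟨a, ha⟩ := hne v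
  have hva := mem_nbrs.1 ha
  have hlabel : ρ (v, a) ≠ none := fun hnone =>
    Finset.eq_empty_iff_forall_notMem.1 hempty (v, a) (mem_labelDarts.2 ⟨hva, hnone⟩)
  obtain ⟨x, hx⟩ := Option.ne_none_iff_exists'.1 hlabel
  have hpos : 0 < ∑ x, doubleArea z H ρ (some x) :=
    Finset.sum_pos' (fun y _ => h.doubleArea_nonneg y)
      ⟨x, Finset.mem_univ x, h.area_inner x ⟨(v, a), mem_labelDarts.2 ⟨hva, hx⟩⟩⟩
  have hsum := sum_doubleArea z H ρ
  rw [Fintype.sum_option, doubleArea, hempty, Finset.sum_empty, zero_add] at hsum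
  exact hpos.ne' hsum

theorem mul_lt_sq_of_add_le {n t b W : ℕ} {c : ℝ} (hc₀ : 0 ≤ c) (hc₆ : c ≤ 6)
    (hct : c * t < (b : ℝ) ^ 2) (hle : n + b ≤ t + W) (hbW : b ≤ W) (hsum : b < W → 6 ≤ W + b) :
    c * n < (W : ℝ) ^ 2 := by
  have hgap : c * ((W : ℝ) - b) ≤ (W + b) * (W - b) := by
    rcases hbW.lt_or_eq with hlt | rfl
    · have hbW' : (0 : ℝ) ≤ W - b := sub_nonneg.2 (by exact_mod_cast hbW)
      exact mul_le_mul_of_nonneg_right (hc₆.trans (by exact_mod_cast hsum hlt)) hbW'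
    · rw [sub_self, mul_zero, mul_zero]
  have hle' : (n : ℝ) ≤ t + (W - b) := by
    rw [← add_sub_assoc, le_sub_iff_add_le]
    exact_mod_cast hle
  calc c * n ≤ c * (t + (W - b)) := mul_le_mul_of_nonneg_left hle' hc₀
    _ = c * t + c * (W - b) := mul_add _ _ _
    _ < b ^ 2 + (W + b) * (W - b) := add_lt_add_of_lt_of_le hct hgap
    _ = W ^ 2 := by ring

end Counting

section Main

open Real

variable {V : Type*}

theorem IsPlaneDrawing.pi_mul_sqrt_three_mul_card_lt [Fintype V] [Nonempty V] {z : V → ℂ}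
    {H : SimpleGraph V} (h : IsPlaneDrawing z H) (hunit : HasUnitEdges z H)
    (hne : ∀ v, (nbrs H v).Nonempty) :
    π * √3 * Fintype.card V < (degreeDeficit H : ℝ) ^ 2 := by
  obtain ⟨ρ, hρ⟩ := h.exists_regionLabelling hne
  have hle := hρ.card_add_card_outer_le hne
  have houter := hρ.card_outer_le_degreeDeficit hunit hne
  have hpos := Finset.card_pos.2 (hρ.outer_nonempty hne)
  have htri : π * √3 * numTriangles z H ρ < ((labelDarts H ρ none).card : ℝ) ^ 2 :=
    calc π * √3 * numTriangles z H ρ = 2 * π * (numTriangles z H ρ * (√3 / 2)) := by ring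
      _ ≤ 2 * π * -doubleArea z H ρ none := by gcongr; exact hρ.numTriangles_mul_le hunit
      _ < _ := hρ.two_pi_mul_neg_doubleArea_lt hunit (hρ.outer_nonempty hne)
  have hsqrt_ge : 1.7 ≤ √3 := le_sqrt_of_sq_le (by norm_num)
  have hsqrt_le : √3 ≤ 1.8 := sqrt_le_iff.2 (by norm_num)
  have hconst_ge : 4 ≤ π * √3 := by nlinarith [pi_gt_three]
  have hconst_le : π * √3 ≤ 6 := by nlinarith [pi_lt_d2]
  refine mul_lt_sq_of_add_le (by positivity) hconst_le htri hle houter fun hlt => ?_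
  by_contra! hsmall
  have hnone : numTriangles z H ρ = 0 := by
    by_contra! hsome
    have hone : (1 : ℝ) ≤ numTriangles z H ρ := by exact_mod_cast Nat.one_le_iff_ne_zero.2 hsome
    have hsq : ((labelDarts H ρ none).card : ℝ) ^ 2 ≤ 2 ^ 2 := by
      gcongr
      exact_mod_cast (by lia : (labelDarts H ρ none).card ≤ 2)
    nlinarith
  have hsix := six_le_degreeDeficit hne (by lia)
  lia

namespace MatchstickGraph

/-- The positions of the vertices as complex numbers. -/
noncomputable def toComplex (G : MatchstickGraph V) (v : V) : ℂ :=
  Complex.orthonormalBasisOneI.repr.symm (G.pos v)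

theorem openSegment_toComplex (G : MatchstickGraph V) (u v : V) :
    openSegment ℝ (G.toComplex u) (G.toComplex v) =
      Complex.orthonormalBasisOneI.repr.symm '' openSegment ℝ (G.pos u) (G.pos v) :=
  (image_openSegment ℝ Complex.orthonormalBasisOneI.repr.symm.toLinearMap.toAffineMap _ _).symm

theorem isPlaneDrawing_toComplex (G : MatchstickGraph V) :
    IsPlaneDrawing G.toComplex G.graph where
  injective := Complex.orthonormalBasisOneI.repr.symm.injective.comp G.pos_injective
  vertex u v w huv := by
    rw [openSegment_toComplex, toComplex,
      Complex.orthonormalBasisOneI.repr.symm.injective.mem_set_image]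
    exact G.vertex_not_mem_edge u v w huv
  edges u v x y huv hxy hne := by
    rw [openSegment_toComplex, openSegment_toComplex,
      Set.disjoint_image_iff Complex.orthonormalBasisOneI.repr.symm.injective]
    exact G.edges_disjoint u v x y huv hxy hne

theorem hasUnitEdges_toComplex (G : MatchstickGraph V) :
    HasUnitEdges G.toComplex G.graph := fun v a hva => by
  rw [← dist_eq_norm, dist_comm, toComplex, toComplex, LinearIsometryEquiv.dist_map,
    G.unit_length v a hva]

variable [Fintype V] (G : MatchstickGraph V) [DecidableRel G.graph.Adj]

theorem card_nbrs (v : V) : (nbrs G.graph v).card = G.graph.degree v := by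
  rw [← SimpleGraph.card_neighborFinset_eq_degree]
  congr 1
  ext
  simp

theorem degreeDeficit_eq (hG : ∀ v, G.graph.degree v ≠ 0) :
    degreeDeficit G.graph =
      4 * G.numDegree 1 + 3 * G.numDegree 2 + 2 * G.numDegree 3 + G.numDegree 4 := by
  simp only [degreeDeficit, card_nbrs, numDegree, Finset.card_filter, Finset.mul_sum,
    ← Finset.sum_add_distrib]
  refine Finset.sum_congr rfl fun v _ => ?_
  have := hG v
  split_ifs <;> lia

end MatchstickGraph

end Main

theorem theorem1 {V : Type*} [Fintype V] [Nonempty V] (G : MatchstickGraph V)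
    [DecidableRel G.graph.Adj] (hG : ∀ v : V, G.graph.degree v ≠ 0) :
    (4 * G.numDegree 1 + 3 * G.numDegree 2 + 2 * G.numDegree 3 + G.numDegree 4 : ℝ) >
      Real.sqrt (Real.pi * Real.sqrt 3 * (Fintype.card V : ℝ)) := by
  have hne (v : V) : (nbrs G.graph v).Nonempty := by
    rw [← Finset.card_pos, G.card_nbrs]
    exact Nat.pos_of_ne_zero (hG v)
  have hlt := G.isPlaneDrawing_toComplex.pi_mul_sqrt_three_mul_card_lt
    G.hasUnitEdges_toComplex hne
  rw [G.degreeDeficit_eq hG] at hlt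
  push_cast at hlt
  exact lt_of_pow_lt_pow_left₀ 2 (by positivity) (by rwa [Real.sq_sqrt (by positivity)])
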